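/- **Theorem.** Let $M^4$ be a connected smooth 4-manifold with a smooth effective action of the torus $T^2=S^1\times S^1$. For coprime integers $p,q$ let $S(p,q)=\{(e^{ip\theta},e^{iq\theta})\mid\theta\in[0,2\pi)\}\subset T^2$, and call the vector field $x\mapsto\frac{d}{dt}\big|_{t=0}(e^{ipt},e^{iqt})\cdot x$ on $M$ the action field of $S(p,q)$. Let $g$ be a smooth Riemannian metric on $M$ that is *diagonal*, which means: 1. the action is diagonal: every isotropy group of a codimension one stratum (that is, every isotropy group which is a circle $S(p,q)$) is either $S(1,0)$ or $S(0,1)$; 2. $g$ is invariant under the action of $T^2$; 3. the action is geometrically polar: the orbit space $\Sigma=M/T^2$ is a smooth surface with corners admitting a smooth immersed section $\sigma:\Sigma\to M$ of the quotient map which is everywhere perpendicular to the orbits; 4. the action fields of $S(1,0)$ and $S(0,1)$ are $g$-orthogonal to each other at every point of $M$. If $g$ has nonnegative sectional curvature, then $g$ has nonnegative isotropic curvature, i.e. $R_{1313}+R_{1414}+R_{2323}+R_{2424}-2R_{1234}\ge 0$ for every orthonormal 4-frame $e_1,\dots,e_4$ at every point of $M$, where $R_{ijkl}=R(e_i,e_j,e_k,e_l)$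 with the sign convention that $R_{ijij}$ is the sectional curvature of the plane spanned by $e_i,e_j$. -/

import Mathlib

open scoped Manifold ContDiff

noncomputable section

namespace Toric4

/-- The coordinate space of a 4-manifold. -/
abbrev E4 : Type := EuclideanSpace ℝ (Fin 4)

/-- The torus `T² = S¹ × S¹`. -/
abbrev Torus : Type := Circle × Circle

/-- The model with corners of `T²`. -/
abbrev torusModel := (𝓡 1).prod (𝓡 1)

/-- A smooth Riemannian metric on the 4-manifold `M`. -/
abbrev Metric (M : Type*) [TopologicalSpace M] [ChartedSpace E4 M] [IsManifold (𝓡 4) ∞ M] :=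
  Bundle.ContMDiffRiemannianMetric (𝓡 4) ∞ E4 (TangentSpace (𝓡 4) : M → Type)

section Curvature

/-! ### Curvature of a metric on a coordinate domain

`G y` is the value at the point `y` of a metric given in coordinates; vectors are identified with
vector fields having constant components. -/

/-- The Christoffel symbol of the first kind
`½ (∂_u G(v, w) + ∂_v G(u, w) - ∂_w G(u, v))`, that is `⟨∇_u v, w⟩`. -/
def christoffelFirst (G : E4 → E4 → E4 → ℝ) (y u v w : E4) : ℝ :=
  (1 / 2) * (fderiv ℝ (fun x => G x v w) y u + fderiv ℝ (fun x => G x u w) y v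
    - fderiv ℝ (fun x => G x u v) y w)

/-- The matrix `G_{ij}` of the metric in the standard basis. -/
def gramMatrix (G : E4 → E4 → E4 → ℝ) (y : E4) : Matrix (Fin 4) (Fin 4) ℝ :=
  Matrix.of fun i j => G y (EuclideanSpace.single i 1) (EuclideanSpace.single j 1)

/-- The Levi-Civita derivative `Γ(u, v) = ∇_u v` of constant vector fields: its `k`-th component is
`∑ l, G^{kl} ⟨∇_u v, e_l⟩`, where `G^{kl}` is the inverse of the matrix of the metric. -/
def christoffel (G : E4 → E4 → E4 → ℝ) (y u v : E4) : E4 :=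
  WithLp.toLp 2 fun k => ∑ l, (gramMatrix G y)⁻¹ k l *
    christoffelFirst G y u v (EuclideanSpace.single l 1)

/-- The curvature `R(u, v) w = ∇_u ∇_v w - ∇_v ∇_u w` for constant vector fields `u, v, w`. -/
def riemann (G : E4 → E4 → E4 → ℝ) (y u v w : E4) : E4 :=
  fderiv ℝ (fun x => christoffel G x v w) y u - fderiv ℝ (fun x => christoffel G x u w) y v
    + christoffel G y u (christoffel G y v w) - christoffel G y v (christoffel G y u w)

/-- The curvature tensor `R(u, v, w, z) = ⟨R(u, v) z, w⟩`, with the convention that `R(u, v, u, v)`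
is the sectional curvature of the plane spanned by orthonormal vectors `u, v`. -/
def curv (G : E4 → E4 → E4 → ℝ) (y u v w z : E4) : ℝ :=
  G y (riemann G y u v z) w

/-- The sectional curvature of the plane spanned by `u` and `v`. -/
def sectionalCurvature (G : E4 → E4 → E4 → ℝ) (y u v : E4) : ℝ :=
  curv G y u v u v / (G y u u * G y v v - G y u v ^ 2)

/-- The isotropic curvature `R₁₃₁₃ + R₁₄₁₄ + R₂₃₂₃ + R₂₄₂₄ - 2 R₁₂₃₄` of a 4-frame. -/
def isotropicCurvature (G : E4 → E4 → E4 → ℝ) (y e₁ e₂ e₃ e₄ : E4) : ℝ :=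
  curv G y e₁ e₃ e₁ e₃ + curv G y e₁ e₄ e₁ e₄ + curv G y e₂ e₃ e₂ e₃ + curv G y e₂ e₄ e₂ e₄
    - 2 * curv G y e₁ e₂ e₃ e₄

end Curvature

variable {M : Type*} [TopologicalSpace M] [ChartedSpace E4 M] [IsManifold (𝓡 4) ∞ M]

/-- The metric `g` read in the preferred chart around `x₀`: the pullback of `g` under the inverse
of the chart. Only its values at points `y` of the target of the chart are meaningful. -/
def metricInChart (g : Metric M) (x₀ : M) (y u v : E4) : ℝ :=
  g.inner ((extChartAt (𝓡 4) x₀).symm y)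
    (mfderiv 𝓘(ℝ, E4) (𝓡 4) (extChartAt (𝓡 4) x₀).symm y u)
    (mfderiv 𝓘(ℝ, E4) (𝓡 4) (extChartAt (𝓡 4) x₀).symm y v)

/-- Nonnegative sectional curvature: at every point (given by its coordinates `y` in any of the
preferred charts) every tangent plane has nonnegative sectional curvature. -/
def NonnegSectionalCurvature (g : Metric M) : Prop :=
  ∀ (x₀ : M), ∀ y ∈ (extChartAt (𝓡 4) x₀).target, ∀ u v : E4, LinearIndependent ℝ ![u, v] →
    0 ≤ sectionalCurvature (metricInChart g x₀) y u v

/-- Nonnegative isotropic curvature: at every point (given by its coordinates `y` in any of the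
preferred charts) every orthonormal 4-frame has nonnegative isotropic curvature. -/
def NonnegIsotropicCurvature (g : Metric M) : Prop :=
  ∀ (x₀ : M), ∀ y ∈ (extChartAt (𝓡 4) x₀).target, ∀ e : Fin 4 → E4,
    (∀ i j, metricInChart g x₀ y (e i) (e j) = if i = j then 1 else 0) →
    0 ≤ isotropicCurvature (metricInChart g x₀) y (e 0) (e 1) (e 2) (e 3)

/-- The circle subgroup `S(a, b) = {(z ^ a, z ^ b) | z ∈ S¹}` of the torus. -/
def circleSubgroup (a b : ℤ) : Subgroup Torus :=
  ((zpowGroupHom a).prod (zpowGroupHom b) : Circle →* Torus).range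

variable [MulAction Torus M]

/-- The action field at `p` of the element `(a, b)` of the Lie algebra `ℝ²` of the torus: the
velocity at `t = 0` of the curve `(exp (i a t), exp (i b t)) • p`. For integers `a, b` this is the
action field of the circle `S(a, b)`. -/
def actionField (a b : ℝ) (p : M) : TangentSpace (𝓡 4) p :=
  (mfderiv 𝓘(ℝ, ℝ) (𝓡 4)
    (fun t : ℝ => ((Circle.exp (a * t), Circle.exp (b * t)) : Torus) • p) 0 (1 : ℝ) : E4)

/-- The torus acts by isometries of `g`. -/
def IsInvariant (g : Metric M) : Prop :=
  ∀ (t : Torus) (p : M) (u v : TangentSpace (𝓡 4) p),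
    g.inner (t • p) (mfderiv (𝓡 4) (𝓡 4) (fun q : M => t • q) p u)
      (mfderiv (𝓡 4) (𝓡 4) (fun q : M => t • q) p v) = g.inner p u v

variable (M) in
/-- The orbit space `Σ = M / T²` with the quotient topology. -/
abbrev OrbitSpace : Type _ := MulAction.orbitRel.Quotient Torus M

/-- The action is geometrically polar: the orbit space is a smooth surface with corners in such a
way that there is a smooth immersed section `σ : M / T² → M` of the quotient map that is
perpendicular to the orbits at every point. (The tangent space of an orbit is spanned by the action
fields. The smooth structure is determined by the section, of which it makes `σ` an immersion.) -/
def IsGeometricallyPolar (g : Metric M) : Prop :=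
  ∃ _ : ChartedSpace (EuclideanQuadrant 2) (OrbitSpace M),
    IsManifold (modelWithCornersEuclideanQuadrant 2) ∞ (OrbitSpace M) ∧
    ∃ σ : OrbitSpace M → M,
      (∀ x : OrbitSpace M, (Quotient.mk _ (σ x) : OrbitSpace M) = x) ∧
      ContMDiff (modelWithCornersEuclideanQuadrant 2) (𝓡 4) ∞ σ ∧
      ∀ x : OrbitSpace M,
        Function.Injective (mfderiv (modelWithCornersEuclideanQuadrant 2) (𝓡 4) σ x) ∧
        ∀ (w : TangentSpace (modelWithCornersEuclideanQuadrant 2) x) (a b : ℝ),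
          g.inner (σ x) (mfderiv (modelWithCornersEuclideanQuadrant 2) (𝓡 4) σ x w)
            (actionField a b (σ x)) = 0

variable (M) in
/-- The action is diagonal: every isotropy group of a codimension one stratum (that is, every
isotropy group which is a circle `S(a, b)` with `gcd(a, b) = 1`) is `S(1, 0)` or `S(0, 1)`. -/
def IsDiagonalAction : Prop :=
  ∀ (p : M) (a b : ℤ), IsCoprime a b → MulAction.stabilizer Torus p = circleSubgroup a b →
    MulAction.stabilizer Torus p = circleSubgroup 1 0 ∨
    MulAction.stabilizer Torus p = circleSubgroup 0 1

/-- A diagonal metric: a metric invariant under a diagonal action which is geometrically polar and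
whose `S(1, 0)` and `S(0, 1)` action fields are orthogonal everywhere. -/
structure IsDiagonalMetric (g : Metric M) : Prop where
  diagonalAction : IsDiagonalAction M
  invariant : IsInvariant g
  polar : IsGeometricallyPolar g
  orthogonal : ∀ p : M, g.inner p (actionField 1 0 p) (actionField 0 1 p) = 0

end Toric4

end

/-! The curvature operator of such a metric turns out to be nonnegative on all 2-vectors, not only
on decomposable ones, and isotropic curvature is a sum of two of its values.

Near a point where neither action field vanishes, a section perpendicular to the orbits, moved
around by the torus, gives coordinates `(z, a, b)` in which the metric is `h(z) + A(z) da² + B(z)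
db²` (`inner_mfderiv_toricMap`). The reflections of `a` and of `b` about their values at the point
are local isometries fixing it, so a component of the curvature vanishes when the index of `a`, or
that of `b`, occurs an odd number of times (`curvForm_affine`). The curvature operator is then block
diagonal. Its blocks are spanned by `∂₀∧∂₁`, by `∂a∧∂b`, by `∂₀∧∂a, ∂₁∧∂a` and by `∂₀∧∂b, ∂₁∧∂b`.
Every element of a block is decomposable, so nonnegative sectional curvature makes each block
nonnegative (`quadratic_nonneg`). The isotropic curvature is the sum of the operator's quadratic
form at `e₁∧e₃ - e₂∧e₄` and at `e₁∧e₄ + e₂∧e₃` (`isotropic_nonneg`).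

The remaining points are reached by continuity. If an action field vanished on an open set, the
involution at time `π` of its circle would be the identity there, hence on all of the connected
manifold (`eq_id_of_involution`), contradicting effectiveness. So the good points are dense
(`dense_actionField_ne_zero`). Perpendicular sections exist through orbits meeting any nonempty open
set, since the interior of the quadrant is dense in it (`exists_isPerpSection`). -/

noncomputable section

namespace Toric4

open Set

set_option maxSynthPendingDepth 3

/-! ### Coordinate-free Levi-Civita calculus on an open subset of a normed space. -/

section LocalMetric

variable {E : Type*} [NormedAddCommGroup E] [NormedSpace ℝ E]

/-- `G` is a smooth Riemannian metric on the open set `U` of the coordinate space. -/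
structure IsMetricOn (G : E → E →L[ℝ] E →L[ℝ] ℝ) (U : Set E) : Prop where
  isOpen : IsOpen U
  contDiffOn : ContDiffOn ℝ ∞ G U
  symm : ∀ y ∈ U, ∀ u v, G y u v = G y v u
  pos : ∀ y ∈ U, ∀ u, u ≠ 0 → 0 < G y u u

/-- The linear map that takes the derivative of a metric to its Christoffel symbols of the first
kind. -/
def christoffelMap : (E →L[ℝ] E →L[ℝ] E →L[ℝ] ℝ) →L[ℝ] (E →L[ℝ] E →L[ℝ] E →L[ℝ] ℝ) :=
  let flip₁ : (E →L[ℝ] E →L[ℝ] E →L[ℝ] ℝ) →L[ℝ] (E →L[ℝ] E →L[ℝ] E →L[ℝ] ℝ) :=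
    ((ContinuousLinearMap.flipₗᵢ ℝ E E (E →L[ℝ] ℝ)).toContinuousLinearEquiv : _ →L[ℝ] _)
  let flip₂ : (E →L[ℝ] E →L[ℝ] E →L[ℝ] ℝ) →L[ℝ] (E →L[ℝ] E →L[ℝ] E →L[ℝ] ℝ) :=
    ContinuousLinearMap.compL ℝ E _ _
      ((ContinuousLinearMap.flipₗᵢ ℝ E E ℝ).toContinuousLinearEquiv : _ →L[ℝ] _)
  (1 / 2 : ℝ) • (ContinuousLinearMap.id ℝ _ + flip₁ - flip₂ ∘L flip₁)

theorem christoffelMap_apply (D : E →L[ℝ] E →L[ℝ] E →L[ℝ] ℝ) (u v w : E) :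
    christoffelMap D u v w = (1 / 2) * (D u v w + D v u w - D w u v) := by
  simp [christoffelMap]

/-- The Christoffel symbols of `G` at `y` as a continuous bilinear map. -/
def christoffelBilin (G : E → E →L[ℝ] E →L[ℝ] ℝ) (y : E) : E →L[ℝ] E →L[ℝ] E :=
  (ContinuousLinearMap.compL ℝ E (E →L[ℝ] ℝ) E (G y).inverse) ∘L christoffelMap (fderiv ℝ G y)

/-- The curvature `R(u, v) w` of `G` at `y`. -/
def riemannBilin (G : E → E →L[ℝ] E →L[ℝ] ℝ) (y u v w : E) : E :=
  fderiv ℝ (christoffelBilin G) y u v w - fderiv ℝ (christoffelBilin G) y v u w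
    + christoffelBilin G y u (christoffelBilin G y v w)
    - christoffelBilin G y v (christoffelBilin G y u w)

/-- The curvature tensor `⟨R(u, v) z, w⟩` of `G` at `y`. -/
def curvForm (G : E → E →L[ℝ] E →L[ℝ] ℝ) (y u v w z : E) : ℝ :=
  G y (riemannBilin G y u v z) w

theorem curvForm_add_left (G : E → E →L[ℝ] E →L[ℝ] ℝ) (y u u' v w z : E) :
    curvForm G y (u + u') v w z
      = curvForm G y u v w z + curvForm G y u' v w z := by
  simp only [curvForm, riemannBilin, map_add, map_sub, add_apply,
    sub_apply]
  ring

theorem curvForm_smul_left (G : E → E →L[ℝ] E →L[ℝ] ℝ) (c : ℝ) (y u v w z : E) :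
    curvForm G y (c • u) v w z = c * curvForm G y u v w z := by
  simp only [curvForm, riemannBilin, map_smul, map_add, map_sub, add_apply,
    sub_apply, smul_apply, smul_eq_mul]
  ring

theorem curvForm_swap_left (G : E → E →L[ℝ] E →L[ℝ] ℝ) (y u v w z : E) :
    curvForm G y u v w z = - curvForm G y v u w z := by
  simp only [curvForm, riemannBilin, map_add, map_sub, add_apply,
    sub_apply]
  ring

namespace IsMetricOn

variable {G : E → E →L[ℝ] E →L[ℝ] ℝ} {U : Set E} {y : E}

theorem mem_nhds (h : IsMetricOn G U) (hy : y ∈ U) : U ∈ nhds y := h.isOpen.mem_nhds hy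

theorem contDiffAt (h : IsMetricOn G U) (hy : y ∈ U) : ContDiffAt ℝ ∞ G y :=
  h.contDiffOn.contDiffAt (h.mem_nhds hy)

theorem differentiableAt (h : IsMetricOn G U) (hy : y ∈ U) : DifferentiableAt ℝ G y :=
  (h.contDiffAt hy).differentiableAt (by simp)

theorem eq_of_forall (h : IsMetricOn G U) (hy : y ∈ U) {a b : E}
    (hab : ∀ w, G y a w = G y b w) : a = b := by
  by_contra hne
  have := h.pos y hy (a - b) (sub_ne_zero.2 hne)
  have h0 : G y (a - b) = 0 := by ext w; simp [hab]
  simp [h0] at this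

theorem fderiv_apply (h : IsMetricOn G U) (hy : y ∈ U) (u v w : E) :
    fderiv ℝ (fun x => G x v w) y u = fderiv ℝ G y u v w := by
  have h1 := ((h.differentiableAt hy).hasFDerivAt.clm_apply (hasFDerivAt_const v y)).clm_apply
    (hasFDerivAt_const w y)
  rw [h1.fderiv]
  simp

theorem fderiv_symm (h : IsMetricOn G U) (hy : y ∈ U) (u v w : E) :
    fderiv ℝ G y u v w = fderiv ℝ G y u w v := by
  rw [← h.fderiv_apply hy, ← h.fderiv_apply hy]
  congr 1
  apply Filter.EventuallyEq.fderiv_eq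
  filter_upwards [h.mem_nhds hy] with x hx using h.symm x hx v w

variable [FiniteDimensional ℝ E]

/-- `ContinuousLinearMap.inverse` is zero on non-invertible maps, so the Christoffel symbols are
meaningful only through this fact. Definiteness gives injectivity, and a space and its dual have
equal dimension. -/
theorem isInvertible (h : IsMetricOn G U) (hy : y ∈ U) : (G y).IsInvertible := by
  have hinj : Function.Injective (G y) := fun a b hab =>
    h.eq_of_forall hy fun w => by rw [hab]
  have hdim : Module.finrank ℝ E = Module.finrank ℝ (E →L[ℝ] ℝ) := by
    rw [← (LinearMap.toContinuousLinearMap (𝕜 := ℝ) (E := E) (F' := ℝ)).finrank_eq]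
    exact (Subspace.dual_finrank_eq (K := ℝ) (V := E)).symm
  refine ⟨(LinearEquiv.ofInjectiveOfFinrankEq (G y).toLinearMap hinj hdim).toContinuousLinearEquiv,
    ?_⟩
  ext u v
  rfl

theorem metric_christoffelBilin (h : IsMetricOn G U) (hy : y ∈ U) (u v w : E) :
    G y (christoffelBilin G y u v) w = christoffelMap (fderiv ℝ G y) u v w := by
  have := (h.isInvertible hy).self_comp_inverse
  have := DFunLike.congr_fun this (christoffelMap (fderiv ℝ G y) u v)
  exact DFunLike.congr_fun this w

theorem christoffelBilin_symm (h : IsMetricOn G U) (hy : y ∈ U) (u v : E) :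
    christoffelBilin G y u v = christoffelBilin G y v u := by
  refine h.eq_of_forall hy fun w => ?_
  rw [h.metric_christoffelBilin hy, h.metric_christoffelBilin hy, christoffelMap_apply,
    christoffelMap_apply, h.fderiv_symm hy w u v]
  ring

/-- Compatibility of the connection with the metric: in the sum of the two Koszul formulas only the
derivative along `u` survives. -/
theorem metric_fderiv (h : IsMetricOn G U) (hy : y ∈ U) (u v w : E) :
    fderiv ℝ G y u v w
      = G y (christoffelBilin G y u v) w + G y v (christoffelBilin G y u w) := by
  rw [h.symm y hy v, h.metric_christoffelBilin hy, h.metric_christoffelBilin hy,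
    christoffelMap_apply, christoffelMap_apply, h.fderiv_symm hy v u w, h.fderiv_symm hy w u v,
    h.fderiv_symm hy u w v]
  ring

theorem contDiffOn_christoffelBilin (h : IsMetricOn G U) :
    ContDiffOn ℝ ∞ (christoffelBilin G) U := by
  intro y hy
  refine ContDiffAt.contDiffWithinAt ?_
  have h1 : ContDiffAt ℝ ∞ (fun x => (G x).inverse) y :=
    (h.isInvertible hy).contDiffAt_map_inverse.comp y (h.contDiffAt hy)
  have h2 : ContDiffAt ℝ ∞ (fun x => christoffelMap (fderiv ℝ G x)) y :=
    christoffelMap.contDiff.contDiffAt.comp y ((h.contDiffAt hy).fderiv_right (by simp))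
  have h3 := (ContinuousLinearMap.compL ℝ E (E →L[ℝ] ℝ) E).contDiff.contDiffAt.comp y h1
  exact ContDiffAt.clm_comp h3 h2

theorem differentiableAt_christoffelBilin (h : IsMetricOn G U) (hy : y ∈ U) :
    DifferentiableAt ℝ (christoffelBilin G) y :=
  (h.contDiffOn_christoffelBilin.contDiffAt (h.mem_nhds hy)).differentiableAt (by simp)

theorem fderiv_christoffelBilin_symm (h : IsMetricOn G U) (hy : y ∈ U) (u v w : E) :
    fderiv ℝ (christoffelBilin G) y u v w = fderiv ℝ (christoffelBilin G) y u w v := by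
  have hd := (h.differentiableAt_christoffelBilin hy).hasFDerivAt
  have h1 := (hd.clm_apply (hasFDerivAt_const v y)).clm_apply (hasFDerivAt_const w y)
  have h2 := ((hd.clm_apply (hasFDerivAt_const w y)).clm_apply
    (hasFDerivAt_const v y)).congr_of_eventuallyEq (f₁ := fun x => christoffelBilin G x v w) (by
      filter_upwards [h.mem_nhds hy] with x hx using h.christoffelBilin_symm hx v w)
  simpa using DFunLike.congr_fun (h1.unique h2) u

/-- First Bianchi identity. The curvature acts on the fourth slot, so the cyclic sum runs over slots
1, 2 and 4; everything cancels by torsion-freeness, used for the Christoffel map and for its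
derivative. -/
theorem curvForm_bianchi (h : IsMetricOn G U) (hy : y ∈ U) (u v w z : E) :
    curvForm G y u v w z + curvForm G y v z w u
      + curvForm G y z u w v = 0 := by
  simp only [curvForm, riemannBilin, map_add, map_sub, add_apply,
    sub_apply]
  rw [h.fderiv_christoffelBilin_symm hy u v z, h.fderiv_christoffelBilin_symm hy v u z,
    h.fderiv_christoffelBilin_symm hy z u v, h.christoffelBilin_symm hy v z,
    h.christoffelBilin_symm hy u z, h.christoffelBilin_symm hy u v]
  ring

/-- The derivative of the identity `⟨∇_v w, z⟩ = Γ₁(v, w, z)` in the direction `u`. -/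
theorem metric_fderiv_christoffelBilin (h : IsMetricOn G U) (hy : y ∈ U) (u v w z : E) :
    G y (fderiv ℝ (christoffelBilin G) y u v w + christoffelBilin G y u (christoffelBilin G y v w)) z
      = christoffelMap (fderiv ℝ (fderiv ℝ G) y u) v w z
        - G y (christoffelBilin G y v w) (christoffelBilin G y u z) := by
  have hDG : DifferentiableAt ℝ (fderiv ℝ G) y :=
    ((h.contDiffAt hy).fderiv_right (m := ∞) (by simp)).differentiableAt (by simp)
  have h1 := ((((christoffelMap.hasFDerivAt.comp y hDG.hasFDerivAt).clm_apply
    (hasFDerivAt_const v y)).clm_apply (hasFDerivAt_const w y)).clm_apply (hasFDerivAt_const z y))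
  have h2 := ((h.differentiableAt hy).hasFDerivAt.clm_apply
    (((h.differentiableAt_christoffelBilin hy).hasFDerivAt.clm_apply
    (hasFDerivAt_const v y)).clm_apply (hasFDerivAt_const w y))).clm_apply (hasFDerivAt_const z y)
  have h3 := h2.congr_of_eventuallyEq (f₁ := fun x => christoffelMap (fderiv ℝ G x) v w z) (by
    filter_upwards [h.mem_nhds hy] with x hx using (h.metric_christoffelBilin hx v w z).symm)
  have := DFunLike.congr_fun (h1.unique h3) u
  simp at this
  rw [this, h.metric_fderiv hy, map_add, add_apply]
  ring

omit [FiniteDimensional ℝ E] in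
theorem christoffelMap_fderiv₂ (h : IsMetricOn G U) (hy : y ∈ U) (u v w z : E) :
    christoffelMap (fderiv ℝ (fderiv ℝ G) y u) v w z + christoffelMap (fderiv ℝ (fderiv ℝ G) y u) v z w
      = fderiv ℝ (fderiv ℝ G) y u v w z := by
  have hDG : DifferentiableAt ℝ (fderiv ℝ G) y :=
    ((h.contDiffAt hy).fderiv_right (m := ∞) (by simp)).differentiableAt (by simp)
  have key : ∀ a b c, fderiv ℝ (fderiv ℝ G) y u a b c = fderiv ℝ (fderiv ℝ G) y u a c b := by
    intro a b c
    have h1 := ((hDG.hasFDerivAt.clm_apply (hasFDerivAt_const a y)).clm_apply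
      (hasFDerivAt_const b y)).clm_apply (hasFDerivAt_const c y)
    have h2 := ((hDG.hasFDerivAt.clm_apply (hasFDerivAt_const a y)).clm_apply
      (hasFDerivAt_const c y)).clm_apply (hasFDerivAt_const b y)
    have h3 := h2.congr_of_eventuallyEq (f₁ := fun x => fderiv ℝ G x a b c) (by
      filter_upwards [h.mem_nhds hy] with x hx using h.fderiv_symm hx a b c)
    simpa using DFunLike.congr_fun (h1.unique h3) u
  rw [christoffelMap_apply, christoffelMap_apply, key w v z, key z v w, key v z w]
  ring

/-- After differentiating the Koszul formula, the products of Christoffel symbols cancel between the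
two orders of `w, z`; what is left is a commutator of second derivatives of `G`, which is zero. -/
theorem curvForm_swap_right (h : IsMetricOn G U) (hy : y ∈ U) (u v w z : E) :
    curvForm G y u v w z = - curvForm G y u v z w := by
  have e : ∀ a b, curvForm G y u v a b =
      christoffelMap (fderiv ℝ (fderiv ℝ G) y u) v b a
        - G y (christoffelBilin G y v b) (christoffelBilin G y u a)
      - (christoffelMap (fderiv ℝ (fderiv ℝ G) y v) u b a
        - G y (christoffelBilin G y u b) (christoffelBilin G y v a)) := fun a b => by
    rw [← h.metric_fderiv_christoffelBilin hy, ← h.metric_fderiv_christoffelBilin hy,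
      ← sub_apply, ← map_sub, curvForm, riemannBilin]
    congr 2
    abel
  have hs : fderiv ℝ (fderiv ℝ G) y u v = fderiv ℝ (fderiv ℝ G) y v u :=
    (h.contDiffAt hy).isSymmSndFDerivAt
      (minSmoothness_of_isRCLikeNormedField.trans_le ENat.LEInfty.out) u v
  have h1 := h.christoffelMap_fderiv₂ hy u v w z
  have h2 := h.christoffelMap_fderiv₂ hy v u w z
  rw [hs] at h1
  rw [e, e, h.symm y hy (christoffelBilin G y v z), h.symm y hy (christoffelBilin G y u z)]
  linarith

/-- The classical octahedron argument: a combination of four Bianchi identities and the two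
antisymmetries. -/
theorem curvForm_swap_pairs (h : IsMetricOn G U) (hy : y ∈ U) (u v w z : E) :
    curvForm G y u v w z = curvForm G y w z u v := by
  have l := curvForm_swap_left G y
  have r := h.curvForm_swap_right hy
  have b := h.curvForm_bianchi hy
  linarith [b u v w z, b v w z u, b w z u v, b z u v w, l u v w z, l u v z w, l v z w u, l v z u w,
    l z u w v, l z u v w, l v w z u, l v w u z, l w u z v, l w u v z, l w z u v, l w z v u,
    r u v w z, r v z w u, r z u w v, r v w z u, r w u z v, r w z u v, r u w z v, r z v u w]

theorem continuousOn_curvForm (h : IsMetricOn G U) (u v w z : E) :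
    ContinuousOn (fun y => curvForm G y u v w z) U := by
  have h1 := h.contDiffOn_christoffelBilin.continuousOn
  have h2 : ContinuousOn (fderiv ℝ (christoffelBilin G)) U :=
    h.contDiffOn_christoffelBilin.continuousOn_fderiv_of_isOpen h.isOpen (by simp)
  have h3 := h.contDiffOn.continuousOn
  have c : ∀ a b, ContinuousOn (fun y => christoffelBilin G y a b) U := fun a b =>
    (h1.clm_apply continuousOn_const).clm_apply continuousOn_const
  have d : ∀ a b c, ContinuousOn (fun y => fderiv ℝ (christoffelBilin G) y a b c) U :=
    fun a b c => ((h2.clm_apply continuousOn_const).clm_apply continuousOn_const).clm_apply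
      continuousOn_const
  have e : ∀ a b c, ContinuousOn
      (fun y => christoffelBilin G y a (christoffelBilin G y b c)) U := fun a b c' =>
    (h1.clm_apply continuousOn_const).clm_apply (c b c')
  exact (h3.clm_apply ((((d u v z).sub (d v u z)).add (e u v z)).sub (e v u z))).clm_apply
    continuousOn_const

end IsMetricOn

end LocalMetric

/-! ### Agreement with the curvature computed from the inverse Gram matrix. -/

namespace IsMetricOn

variable {G : E4 → E4 →L[ℝ] E4 →L[ℝ] ℝ} {U : Set E4} {y : E4}

theorem christoffel_eq (h : IsMetricOn G U) (hy : y ∈ U) (u v : E4) :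
    christoffel (fun x a b => G x a b) y u v = christoffelBilin G y u v := by
  set A := gramMatrix (fun x a b => G x a b) y with hA
  have hexp : ∀ x : E4, x = ∑ i, x i • EuclideanSpace.single i (1 : ℝ) := fun x => by
    ext j; simp [Finset.sum_apply, Pi.single_apply]
  -- A kernel vector of the Gram matrix is `G`-orthogonal to every basis vector, hence zero by
  -- definiteness.
  have hdet : IsUnit A.det := by
    rw [← Matrix.isUnit_iff_isUnit_det, ← Matrix.mulVec_injective_iff_isUnit]
    refine (injective_iff_map_eq_zero (Matrix.mulVecLin A)).2 fun x hx => ?_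
    have h0 : G y (WithLp.toLp 2 x) = 0 := by
      ext w
      rw [hexp w, h.symm y hy]
      simp only [map_sum, map_smul, sum_apply, smul_apply,
        zero_apply, smul_zero, Finset.sum_const_zero]
      refine Finset.sum_eq_zero fun i _ => ?_
      have := congrFun hx i
      simp only [Matrix.mulVecLin_apply, Matrix.mulVec, dotProduct, Pi.zero_apply, hA, gramMatrix,
        Matrix.of_apply] at this
      rw [hexp (WithLp.toLp 2 x)]
      simp only [map_sum, map_smul, smul_eq_mul]
      rw [Finset.sum_congr rfl fun j _ => mul_comm _ _, this, mul_zero]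
    by_contra hne
    have hp := h.pos y hy (WithLp.toLp 2 x) (fun h' => hne (by simpa using congrArg WithLp.ofLp h'))
    simp [h0] at hp
  have hc : ∀ l, christoffelFirst (fun x a b => G x a b) y u v (EuclideanSpace.single l 1)
      = G y (christoffelBilin G y u v) (EuclideanSpace.single l 1) := fun l => by
    rw [h.metric_christoffelBilin hy, christoffelMap_apply, christoffelFirst, h.fderiv_apply hy,
      h.fderiv_apply hy, h.fderiv_apply hy]
  set b := christoffelBilin G y u v
  have hb : ∀ l, G y b (EuclideanSpace.single l 1) = (A.mulVec b.ofLp) l := fun l => by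
    rw [h.symm y hy]
    conv_lhs => rw [hexp b]
    simp only [map_sum, map_smul, Matrix.mulVec, dotProduct, hA, gramMatrix, Matrix.of_apply,
      smul_eq_mul]
    exact Finset.sum_congr rfl fun _ _ => mul_comm _ _
  ext k
  have : (A⁻¹.mulVec (A.mulVec b.ofLp)) k = b k := by
    rw [Matrix.mulVec_mulVec, Matrix.nonsing_inv_mul _ hdet, Matrix.one_mulVec]
  rw [← this]
  simp only [christoffel, hc, hb, ← hA]
  rfl

theorem fderiv_christoffel (h : IsMetricOn G U) (hy : y ∈ U) (u v w : E4) :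
    fderiv ℝ (fun x => christoffel (fun x a b => G x a b) x v w) y u
      = fderiv ℝ (christoffelBilin G) y u v w := by
  have h1 := ((h.differentiableAt_christoffelBilin hy).hasFDerivAt.clm_apply
    (hasFDerivAt_const v y)).clm_apply (hasFDerivAt_const w y)
  have h2 : (fun x => christoffel (fun x a b => G x a b) x v w) =ᶠ[nhds y]
      fun x => christoffelBilin G x v w := by
    filter_upwards [h.mem_nhds hy] with x hx using h.christoffel_eq hx v w
  rw [h2.fderiv_eq, h1.fderiv]
  simp

theorem riemann_eq (h : IsMetricOn G U) (hy : y ∈ U) (u v w : E4) :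
    riemann (fun x a b => G x a b) y u v w
      = fderiv ℝ (christoffelBilin G) y u v w - fderiv ℝ (christoffelBilin G) y v u w
        + christoffelBilin G y u (christoffelBilin G y v w)
        - christoffelBilin G y v (christoffelBilin G y u w) := by
  rw [riemann, h.fderiv_christoffel hy, h.fderiv_christoffel hy, h.christoffel_eq hy,
    h.christoffel_eq hy, h.christoffel_eq hy, h.christoffel_eq hy]

theorem curv_eq (h : IsMetricOn G U) (hy : y ∈ U) (u v w z : E4) :
    curv (fun x a b => G x a b) y u v w z = curvForm G y u v w z := by
  rw [curv, h.riemann_eq hy]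
  rfl

end IsMetricOn

/-! ### Invariance of the curvature under local isometries. -/

section Naturality

variable {E F : Type*} [NormedAddCommGroup E] [NormedSpace ℝ E] [FiniteDimensional ℝ E]
  [NormedAddCommGroup F] [NormedSpace ℝ F] [FiniteDimensional ℝ F]

/-- `f` is a smooth local isometry from the metric `G'` on `U'` to the metric `G` on `U`. -/
structure IsIsometryOn (f : F → E) (G' : F → F →L[ℝ] F →L[ℝ] ℝ) (U' : Set F)
    (G : E → E →L[ℝ] E →L[ℝ] ℝ) (U : Set E) : Prop where
  metric_source : IsMetricOn G' U'
  metric_target : IsMetricOn G U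
  contDiffOn : ContDiffOn ℝ ∞ f U'
  mapsTo : MapsTo f U' U
  pullback : ∀ y ∈ U', ∀ u v, G' y u v = G (f y) (fderiv ℝ f y u) (fderiv ℝ f y v)

namespace IsIsometryOn

variable {f : F → E} {G' : F → F →L[ℝ] F →L[ℝ] ℝ} {U' : Set F}
  {G : E → E →L[ℝ] E →L[ℝ] ℝ} {U : Set E} {y : F}

omit [FiniteDimensional ℝ E] [FiniteDimensional ℝ F] in
theorem contDiffAt (h : IsIsometryOn f G' U' G U) (hy : y ∈ U') : ContDiffAt ℝ ∞ f y :=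
  h.contDiffOn.contDiffAt (h.metric_source.mem_nhds hy)

omit [FiniteDimensional ℝ E] [FiniteDimensional ℝ F] in
theorem contDiffAt_fderiv (h : IsIsometryOn f G' U' G U) (hy : y ∈ U') :
    ContDiffAt ℝ ∞ (fderiv ℝ f) y :=
  (h.contDiffAt hy).fderiv_right (by simp)

omit [FiniteDimensional ℝ E] [FiniteDimensional ℝ F] in
theorem hasFDerivAt (h : IsIsometryOn f G' U' G U) (hy : y ∈ U') :
    HasFDerivAt f (fderiv ℝ f y) y :=
  ((h.contDiffAt hy).differentiableAt (by simp)).hasFDerivAt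

omit [FiniteDimensional ℝ E] [FiniteDimensional ℝ F] in
theorem hasFDerivAt_fderiv (h : IsIsometryOn f G' U' G U) (hy : y ∈ U') :
    HasFDerivAt (fderiv ℝ f) (fderiv ℝ (fderiv ℝ f) y) y :=
  ((h.contDiffAt_fderiv hy).differentiableAt (by simp)).hasFDerivAt

omit [FiniteDimensional ℝ E] [FiniteDimensional ℝ F] in
theorem fderiv₂_symm (h : IsIsometryOn f G' U' G U) (hy : y ∈ U') (u v : F) :
    fderiv ℝ (fderiv ℝ f) y u v = fderiv ℝ (fderiv ℝ f) y v u :=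
  (h.contDiffAt hy).isSymmSndFDerivAt
    (minSmoothness_of_isRCLikeNormedField.trans_le ENat.LEInfty.out) u v

omit [FiniteDimensional ℝ E] [FiniteDimensional ℝ F] in
theorem fderiv₃_symm (h : IsIsometryOn f G' U' G U) (hy : y ∈ U') (u v : F) :
    fderiv ℝ (fderiv ℝ (fderiv ℝ f)) y u v = fderiv ℝ (fderiv ℝ (fderiv ℝ f)) y v u :=
  (h.contDiffAt_fderiv hy).isSymmSndFDerivAt
    (minSmoothness_of_isRCLikeNormedField.trans_le ENat.LEInfty.out) u v

omit [FiniteDimensional ℝ E] [FiniteDimensional ℝ F] in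
theorem injective (h : IsIsometryOn f G' U' G U) (hy : y ∈ U') :
    Function.Injective (fderiv ℝ f y) := by
  refine (injective_iff_map_eq_zero _).2 fun u hu => ?_
  by_contra hne
  have := h.metric_source.pos y hy u hne
  simp [h.pullback y hy, hu] at this

theorem surjective (h : IsIsometryOn f G' U' G U)
    (hdim : Module.finrank ℝ F = Module.finrank ℝ E) (hy : y ∈ U') :
    Function.Surjective (fderiv ℝ f y) :=
  (LinearMap.injective_iff_surjective_of_finrank_eq_finrank (f := (fderiv ℝ f y).toLinearMap)
    hdim).1 (h.injective hy)

omit [FiniteDimensional ℝ E] [FiniteDimensional ℝ F] in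
theorem fderiv_metric (h : IsIsometryOn f G' U' G U) (hy : y ∈ U') (a u v : F) :
    fderiv ℝ G' y a u v =
      fderiv ℝ G (f y) (fderiv ℝ f y a) (fderiv ℝ f y u) (fderiv ℝ f y v)
        + G (f y) (fderiv ℝ (fderiv ℝ f) y a u) (fderiv ℝ f y v)
        + G (f y) (fderiv ℝ f y u) (fderiv ℝ (fderiv ℝ f) y a v) := by
  have h0 := (h.metric_target.differentiableAt (h.mapsTo hy)).hasFDerivAt.comp y (h.hasFDerivAt hy)
  have hu := (h.hasFDerivAt_fderiv hy).clm_apply (hasFDerivAt_const u y)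
  have hv := (h.hasFDerivAt_fderiv hy).clm_apply (hasFDerivAt_const v y)
  have h1 := (h0.clm_apply hu).clm_apply hv
  have h2 := h1.congr_of_eventuallyEq (f₁ := fun x => G' x u v) (by
    filter_upwards [h.metric_source.mem_nhds hy] with x hx using h.pullback x hx u v)
  rw [← h.metric_source.fderiv_apply hy, h2.fderiv]
  simp
  ring

/-- The transformation rule of the Christoffel symbols. -/
theorem fderiv_christoffelBilin (h : IsIsometryOn f G' U' G U)
    (hdim : Module.finrank ℝ F = Module.finrank ℝ E) (hy : y ∈ U') (u v : F) :
    fderiv ℝ f y (christoffelBilin G' y u v) = fderiv ℝ (fderiv ℝ f) y u v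
      + christoffelBilin G (f y) (fderiv ℝ f y u) (fderiv ℝ f y v) := by
  have hG := h.metric_target
  have hfy := h.mapsTo hy
  refine hG.eq_of_forall hfy fun w => ?_
  obtain ⟨w, rfl⟩ := h.surjective hdim hy w
  rw [← h.pullback y hy, h.metric_source.metric_christoffelBilin hy, map_add, add_apply,
    hG.metric_christoffelBilin hfy, christoffelMap_apply, christoffelMap_apply,
    h.fderiv_metric hy, h.fderiv_metric hy, h.fderiv_metric hy, h.fderiv₂_symm hy w u,
    h.fderiv₂_symm hy w v, h.fderiv₂_symm hy v u,
    hG.symm _ hfy (fderiv ℝ (fderiv ℝ f) y u w), hG.symm _ hfy (fderiv ℝ f y u)]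
  ring

/-- Local isometries preserve the curvature. -/
theorem fderiv_riemannBilin (h : IsIsometryOn f G' U' G U)
    (hdim : Module.finrank ℝ F = Module.finrank ℝ E) (hy : y ∈ U') (u v w : F) :
    fderiv ℝ f y (riemannBilin G' y u v w)
      = riemannBilin G (f y) (fderiv ℝ f y u) (fderiv ℝ f y v) (fderiv ℝ f y w) := by
  -- This is the derivative of the transformation rule of the Christoffel symbols. The terms
  -- containing second or third derivatives of `f` are jointly symmetric in `a, b`, so
  -- antisymmetrizing leaves only the curvature of `G`.
  have key : ∀ a b, fderiv ℝ f y (fderiv ℝ (christoffelBilin G') y a b w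
        + christoffelBilin G' y a (christoffelBilin G' y b w)) =
      fderiv ℝ (fderiv ℝ (fderiv ℝ f)) y a b w
      + fderiv ℝ (christoffelBilin G) (f y) (fderiv ℝ f y a) (fderiv ℝ f y b) (fderiv ℝ f y w)
      + christoffelBilin G (f y) (fderiv ℝ (fderiv ℝ f) y a b) (fderiv ℝ f y w)
      + (christoffelBilin G (f y) (fderiv ℝ f y b) (fderiv ℝ (fderiv ℝ f) y a w)
        + christoffelBilin G (f y) (fderiv ℝ f y a) (fderiv ℝ (fderiv ℝ f) y b w))
      + christoffelBilin G (f y) (fderiv ℝ f y a)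
          (christoffelBilin G (f y) (fderiv ℝ f y b) (fderiv ℝ f y w)) := fun a b => by
    have hf2 : HasFDerivAt (fderiv ℝ (fderiv ℝ f)) (fderiv ℝ (fderiv ℝ (fderiv ℝ f)) y) y :=
      (((h.contDiffAt_fderiv hy).fderiv_right (m := ∞) (by simp)).differentiableAt
        (by simp)).hasFDerivAt
    have hl := (h.hasFDerivAt_fderiv hy).clm_apply
      ((((h.metric_source.differentiableAt_christoffelBilin hy).hasFDerivAt.clm_apply
      (hasFDerivAt_const b y)).clm_apply (hasFDerivAt_const w y)))
    have hb := (h.hasFDerivAt_fderiv hy).clm_apply (hasFDerivAt_const b y)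
    have hw := (h.hasFDerivAt_fderiv hy).clm_apply (hasFDerivAt_const w y)
    have hr := ((hf2.clm_apply (hasFDerivAt_const b y)).clm_apply (hasFDerivAt_const w y)).add
      (((((h.metric_target.differentiableAt_christoffelBilin
        (h.mapsTo hy)).hasFDerivAt.comp y (h.hasFDerivAt hy)).clm_apply hb)).clm_apply hw)
    have hl' := hr.congr_of_eventuallyEq
      (f₁ := fun x => fderiv ℝ f x (christoffelBilin G' x b w)) (by
        filter_upwards [h.metric_source.mem_nhds hy] with x hx using
          h.fderiv_christoffelBilin hdim hx b w)
    have e := DFunLike.congr_fun (hl.unique hl') a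
    simp at e
    rw [map_add, h.fderiv_christoffelBilin hdim hy a, h.fderiv_christoffelBilin hdim hy b, map_add,
      ← sub_eq_zero]
    rw [← sub_eq_zero] at e
    rw [← e]
    abel
  have e : riemannBilin G' y u v w = (fderiv ℝ (christoffelBilin G') y u v w
        + christoffelBilin G' y u (christoffelBilin G' y v w)) -
        (fderiv ℝ (christoffelBilin G') y v u w
        + christoffelBilin G' y v (christoffelBilin G' y u w)) := by
    rw [riemannBilin]
    abel
  rw [e, map_sub, key, key, h.fderiv₃_symm hy u v, h.fderiv₂_symm hy u v, riemannBilin]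
  abel

theorem curvForm_eq (h : IsIsometryOn f G' U' G U)
    (hdim : Module.finrank ℝ F = Module.finrank ℝ E) (hy : y ∈ U') (u v w z : F) :
    curvForm G (f y) (fderiv ℝ f y u) (fderiv ℝ f y v) (fderiv ℝ f y w) (fderiv ℝ f y z)
      = curvForm G' y u v w z := by
  rw [curvForm, ← h.fderiv_riemannBilin hdim hy, ← h.pullback y hy]
  rfl

end IsIsometryOn

omit [FiniteDimensional ℝ E] in
/-- A smooth immersion is a local isometry from the pulled back metric. -/
theorem IsMetricOn.isIsometryOn_pullback {f : F → E} {U' : Set F} {G : E → E →L[ℝ] E →L[ℝ] ℝ}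
    {U : Set E} (h : IsMetricOn G U) (hU' : IsOpen U') (hf : ContDiffOn ℝ ∞ f U')
    (hmaps : MapsTo f U' U) (hinj : ∀ y ∈ U', ∀ u, fderiv ℝ f y u = 0 → u = 0) :
    IsIsometryOn f (fun y => (G (f y)).bilinearComp (fderiv ℝ f y) (fderiv ℝ f y)) U' G U where
  metric_source :=
    { isOpen := hU'
      contDiffOn := by
        refine contDiffOn_clm_apply.2 fun u => contDiffOn_clm_apply.2 fun v => ?_
        have hd : ContDiffOn ℝ ∞ (fderiv ℝ f) U' := hf.fderiv_of_isOpen hU' (by simp)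
        exact ((h.contDiffOn.comp hf hmaps).clm_apply (hd.clm_apply contDiffOn_const)).clm_apply
          (hd.clm_apply contDiffOn_const)
      symm := fun y hy u v => h.symm _ (hmaps hy) _ _
      pos := fun y hy u hu => h.pos _ (hmaps hy) _ fun h0 => hu (hinj y hy u h0) }
  metric_target := h
  contDiffOn := hf
  mapsTo := hmaps
  pullback _ _ _ _ := rfl

omit [FiniteDimensional ℝ E] in
theorem IsMetricOn.mono {G : E → E →L[ℝ] E →L[ℝ] ℝ} {U V : Set E} (h : IsMetricOn G U)
    (hV : IsOpen V) (hVU : V ⊆ U) : IsMetricOn G V where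
  isOpen := hV
  contDiffOn := h.contDiffOn.mono hVU
  symm y hy := h.symm y (hVU hy)
  pos y hy := h.pos y (hVU hy)

/-- An affine symmetry of a metric preserves the curvature at its fixed points. -/
theorem IsMetricOn.curvForm_affine {G : E → E →L[ℝ] E →L[ℝ] ℝ} {U : Set E} (h : IsMetricOn G U)
    {S : E →L[ℝ] E} {c y : E} (hy : y ∈ U) (hfix : S y + c = y)
    (hS : ∀ x ∈ U, S x + c ∈ U → ∀ u v, G (S x + c) (S u) (S v) = G x u v) (u v w z : E) :
    curvForm G y (S u) (S v) (S w) (S z) = curvForm G y u v w z := by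
  have hcont : Continuous fun x => S x + c := S.continuous.add continuous_const
  have hd : ∀ x, fderiv ℝ (fun x => S x + c) x = S := fun x =>
    (S.hasFDerivAt.add_const c).fderiv
  have hiso : IsIsometryOn (fun x => S x + c) G (U ∩ (fun x => S x + c) ⁻¹' U) G U :=
    { metric_source := h.mono (h.isOpen.inter (h.isOpen.preimage hcont)) inter_subset_left
      metric_target := h
      contDiffOn := (S.contDiff.add contDiff_const).contDiffOn
      mapsTo := fun x hx => hx.2
      pullback := fun x hx u v => by
        rw [hd]
        exact (hS x hx.1 hx.2 u v).symm }
  have key := hiso.curvForm_eq rfl (y := y) ⟨hy, by simpa [hfix] using hy⟩ u v w z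
  simpa only [hd, hfix] using key

end Naturality

/-! ### Algebraic curvature tensors with two reflection symmetries. -/

section Algebra

/-- A function of four vectors with the linearity and the (anti)symmetries of a curvature tensor. -/
structure IsCurvatureLike {V : Type*} [AddCommGroup V] [Module ℝ V] (R : V → V → V → V → ℝ) :
    Prop where
  add_left : ∀ u u' v w z, R (u + u') v w z = R u v w z + R u' v w z
  smul_left : ∀ (c : ℝ) u v w z, R (c • u) v w z = c * R u v w z
  swap_left : ∀ u v w z, R u v w z = - R v u w z
  swap_pairs : ∀ u v w z, R u v w z = R w z u v

namespace IsCurvatureLike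

variable {V : Type*} [AddCommGroup V] [Module ℝ V] {R : V → V → V → V → ℝ}

theorem self_left (h : IsCurvatureLike R) (u w z : V) : R u u w z = 0 := by
  linarith [h.swap_left u u w z]

theorem add_two (h : IsCurvatureLike R) (u v v' w z : V) :
    R u (v + v') w z = R u v w z + R u v' w z := by
  rw [h.swap_left, h.add_left, h.swap_left v, h.swap_left v']
  ring

theorem smul_two (h : IsCurvatureLike R) (c : ℝ) (u v w z : V) :
    R u (c • v) w z = c * R u v w z := by
  rw [h.swap_left, h.smul_left, h.swap_left v]
  ring

theorem expand_left (h : IsCurvatureLike R) (b : Fin 4 → V) (x y : Fin 4 → ℝ) (w z : V) :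
    R (∑ i, x i • b i) (∑ i, y i • b i) w z =
      (x 0 * y 1 - x 1 * y 0) * R (b 0) (b 1) w z + (x 0 * y 2 - x 2 * y 0) * R (b 0) (b 2) w z
      + (x 0 * y 3 - x 3 * y 0) * R (b 0) (b 3) w z + (x 1 * y 2 - x 2 * y 1) * R (b 1) (b 2) w z
      + (x 1 * y 3 - x 3 * y 1) * R (b 1) (b 3) w z
      + (x 2 * y 3 - x 3 * y 2) * R (b 2) (b 3) w z := by
  simp only [Fin.sum_univ_four, h.add_left, h.smul_left, h.add_two, h.smul_two, h.self_left]
  rw [h.swap_left (b 1) (b 0), h.swap_left (b 2) (b 0), h.swap_left (b 3) (b 0),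
    h.swap_left (b 2) (b 1), h.swap_left (b 3) (b 1), h.swap_left (b 3) (b 2)]
  ring

theorem expand_right (h : IsCurvatureLike R) (b : Fin 4 → V) (x y : Fin 4 → ℝ) (w z : V) :
    R w z (∑ i, x i • b i) (∑ i, y i • b i) =
      (x 0 * y 1 - x 1 * y 0) * R w z (b 0) (b 1) + (x 0 * y 2 - x 2 * y 0) * R w z (b 0) (b 2)
      + (x 0 * y 3 - x 3 * y 0) * R w z (b 0) (b 3) + (x 1 * y 2 - x 2 * y 1) * R w z (b 1) (b 2)
      + (x 1 * y 3 - x 3 * y 1) * R w z (b 1) (b 3)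
      + (x 2 * y 3 - x 3 * y 2) * R w z (b 2) (b 3) := by
  rw [h.swap_pairs, h.expand_left]
  simp only [fun i j => h.swap_pairs (b i) (b j) w z]

/-- The 2-vector `s e₀∧e₂ + t e₁∧e₂ = (s e₀ + t e₁)∧e₂` is decomposable, so the curvature form on it
is covered by the hypothesis on planes. -/
theorem quadratic_nonneg (h : IsCurvatureLike R) (hpos : ∀ u v, 0 ≤ R u v u v) (e₀ e₁ e₂ : V)
    (s t : ℝ) :
    0 ≤ s ^ 2 * R e₀ e₂ e₀ e₂ + 2 * (s * t) * R e₀ e₂ e₁ e₂ + t ^ 2 * R e₁ e₂ e₁ e₂ := by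
  have key := hpos (s • e₀ + t • e₁) e₂
  rw [h.add_left, h.smul_left, h.smul_left, h.swap_pairs e₀, h.swap_pairs e₁, h.add_left,
    h.add_left, h.smul_left, h.smul_left, h.smul_left, h.smul_left, h.swap_pairs e₁ e₂ e₀] at key
  linarith

/-- A curvature tensor that is nonnegative on planes and invariant under two of the reflections of a
basis has nonnegative isotropic curvature. -/
theorem isotropic_nonneg (h : IsCurvatureLike R) (hpos : ∀ u v, 0 ≤ R u v u v) (b : Fin 4 → V)
    (hb : ∀ v, ∃ x : Fin 4 → ℝ, v = ∑ i, x i • b i)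
    (hrefl : ∀ m : Fin 4, m = 2 ∨ m = 3 → ∀ i j k l,
      R ((if i = m then (-1 : ℝ) else 1) • b i) ((if j = m then (-1 : ℝ) else 1) • b j)
        ((if k = m then (-1 : ℝ) else 1) • b k) ((if l = m then (-1 : ℝ) else 1) • b l)
      = R (b i) (b j) (b k) (b l)) (e₁ e₂ e₃ e₄ : V) :
    0 ≤ R e₁ e₃ e₁ e₃ + R e₁ e₄ e₁ e₄ + R e₂ e₃ e₂ e₃ + R e₂ e₄ e₂ e₄ - 2 * R e₁ e₂ e₃ e₄ := by
  have hrefl' : ∀ m : Fin 4, m = 2 ∨ m = 3 → ∀ i j k l,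
      (if i = m then (-1 : ℝ) else 1) * ((if j = m then (-1 : ℝ) else 1) *
        ((if k = m then (-1 : ℝ) else 1) * ((if l = m then (-1 : ℝ) else 1)
        * R (b i) (b j) (b k) (b l)))) = R (b i) (b j) (b k) (b l) := fun m hm i j k l => by
    conv_rhs => rw [← hrefl m hm i j k l]
    rw [h.smul_left, h.smul_two, h.swap_pairs (b i) (b j) (_ • _), h.smul_left, h.smul_two,
      h.swap_pairs (b k)]
  -- Parity: a component in which the index 2, or the index 3, occurs an odd number of times equals
  -- its own negative. This removes all off-diagonal components of the curvature operator except
  -- `R₀₂₁₂` and `R₀₃₁₃`.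
  have z2 := fun i j k l => hrefl' 2 (Or.inl rfl) i j k l
  have z3 := fun i j k l => hrefl' 3 (Or.inr rfl) i j k l
  have h0102 : R (b 0) (b 1) (b 0) (b 2) = 0 := by
    have := z2 0 1 0 2; simp at this; linarith
  have h0112 : R (b 0) (b 1) (b 1) (b 2) = 0 := by
    have := z2 0 1 1 2; simp at this; linarith
  have h0103 : R (b 0) (b 1) (b 0) (b 3) = 0 := by
    have := z3 0 1 0 3; simp at this; linarith
  have h0113 : R (b 0) (b 1) (b 1) (b 3) = 0 := by
    have := z3 0 1 1 3; simp at this; linarith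
  have h0123 : R (b 0) (b 1) (b 2) (b 3) = 0 := by
    have := z3 0 1 2 3; simp at this; linarith
  have h0203 : R (b 0) (b 2) (b 0) (b 3) = 0 := by
    have := z3 0 2 0 3; simp at this; linarith
  have h0213 : R (b 0) (b 2) (b 1) (b 3) = 0 := by
    have := z3 0 2 1 3; simp at this; linarith
  have h0223 : R (b 0) (b 2) (b 2) (b 3) = 0 := by
    have := z3 0 2 2 3; simp at this; linarith
  have h0312 : R (b 0) (b 3) (b 1) (b 2) = 0 := by
    have := z3 0 3 1 2; simp at this; linarith
  have h0323 : R (b 0) (b 3) (b 2) (b 3) = 0 := by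
    have := z2 0 3 2 3; simp at this; linarith
  have h1213 : R (b 1) (b 2) (b 1) (b 3) = 0 := by
    have := z3 1 2 1 3; simp at this; linarith
  have h1223 : R (b 1) (b 2) (b 2) (b 3) = 0 := by
    have := z3 1 2 2 3; simp at this; linarith
  have h1323 : R (b 1) (b 3) (b 2) (b 3) = 0 := by
    have := z2 1 3 2 3; simp at this; linarith
  have formula : ∀ x y p q : Fin 4 → ℝ,
      R (∑ i, x i • b i) (∑ i, y i • b i) (∑ i, p i • b i) (∑ i, q i • b i) =
      (x 0 * y 1 - x 1 * y 0) * (p 0 * q 1 - p 1 * q 0) * R (b 0) (b 1) (b 0) (b 1)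
      + (x 2 * y 3 - x 3 * y 2) * (p 2 * q 3 - p 3 * q 2) * R (b 2) (b 3) (b 2) (b 3)
      + ((x 0 * y 2 - x 2 * y 0) * (p 0 * q 2 - p 2 * q 0) * R (b 0) (b 2) (b 0) (b 2)
      + ((x 0 * y 2 - x 2 * y 0) * (p 1 * q 2 - p 2 * q 1)
        + (x 1 * y 2 - x 2 * y 1) * (p 0 * q 2 - p 2 * q 0)) * R (b 0) (b 2) (b 1) (b 2)
      + (x 1 * y 2 - x 2 * y 1) * (p 1 * q 2 - p 2 * q 1) * R (b 1) (b 2) (b 1) (b 2))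
      + ((x 0 * y 3 - x 3 * y 0) * (p 0 * q 3 - p 3 * q 0) * R (b 0) (b 3) (b 0) (b 3)
      + ((x 0 * y 3 - x 3 * y 0) * (p 1 * q 3 - p 3 * q 1)
        + (x 1 * y 3 - x 3 * y 1) * (p 0 * q 3 - p 3 * q 0)) * R (b 0) (b 3) (b 1) (b 3)
      + (x 1 * y 3 - x 3 * y 1) * (p 1 * q 3 - p 3 * q 1) * R (b 1) (b 3) (b 1) (b 3)) := by
    intro x y p q
    rw [h.expand_left]
    simp only [h.expand_right]
    rw [h.swap_pairs (b 0) (b 2) (b 0) (b 1), h.swap_pairs (b 0) (b 3) (b 0) (b 1),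
      h.swap_pairs (b 1) (b 2) (b 0) (b 1), h.swap_pairs (b 1) (b 3) (b 0) (b 1),
      h.swap_pairs (b 2) (b 3) (b 0) (b 1), h.swap_pairs (b 0) (b 3) (b 0) (b 2),
      h.swap_pairs (b 1) (b 2) (b 0) (b 2), h.swap_pairs (b 1) (b 3) (b 0) (b 2),
      h.swap_pairs (b 2) (b 3) (b 0) (b 2), h.swap_pairs (b 1) (b 2) (b 0) (b 3),
      h.swap_pairs (b 1) (b 3) (b 0) (b 3), h.swap_pairs (b 2) (b 3) (b 0) (b 3),
      h.swap_pairs (b 1) (b 3) (b 1) (b 2), h.swap_pairs (b 2) (b 3) (b 1) (b 2),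
      h.swap_pairs (b 2) (b 3) (b 1) (b 3), h0102, h0112, h0103, h0113, h0123, h0203, h0213,
      h0223, h0312, h0323, h1213, h1223, h1323]
    ring
  obtain ⟨x, rfl⟩ := hb e₁
  obtain ⟨y, rfl⟩ := hb e₂
  obtain ⟨p, rfl⟩ := hb e₃
  obtain ⟨q, rfl⟩ := hb e₄
  simp only [formula]
  have A := hpos (b 0) (b 1)
  have B := hpos (b 2) (b 3)
  have Q2 := h.quadratic_nonneg hpos (b 0) (b 1) (b 2)
  have Q3 := h.quadratic_nonneg hpos (b 0) (b 1) (b 3)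
  -- `m x y i j` are the Plücker coordinates of `x∧y`, and `α`, `β` are those of `e₁∧e₃ - e₂∧e₄` and
  -- `e₁∧e₄ + e₂∧e₃`. The Bianchi identity that would convert the cross terms into `-2 R₁₂₃₄` is
  -- already built into the explicit block formula, as no component with four distinct indices
  -- remains.
  let m : (Fin 4 → ℝ) → (Fin 4 → ℝ) → Fin 4 → Fin 4 → ℝ := fun x y i j => x i * y j - x j * y i
  let α := fun i j => m x p i j - m y q i j
  let β := fun i j => m x q i j + m y p i j
  have hA := mul_nonneg (add_nonneg (sq_nonneg (α 0 1)) (sq_nonneg (β 0 1))) A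
  have hB := mul_nonneg (add_nonneg (sq_nonneg (α 2 3)) (sq_nonneg (β 2 3))) B
  refine (add_nonneg (add_nonneg (add_nonneg hA hB) (add_nonneg (Q2 (α 0 2) (α 1 2))
    (Q2 (β 0 2) (β 1 2)))) (add_nonneg (Q3 (α 0 3) (α 1 3)) (Q3 (β 0 3) (β 1 3)))).trans_eq ?_
  simp only [α, β, m]
  ring

end IsCurvatureLike

end Algebra

section Reflection

variable {F : Type*} [NormedAddCommGroup F] [NormedSpace ℝ F] [FiniteDimensional ℝ F]

theorem IsMetricOn.isCurvatureLike {G : F → F →L[ℝ] F →L[ℝ] ℝ} {U : Set F} (h : IsMetricOn G U)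
    {y : F} (hy : y ∈ U) : IsCurvatureLike (curvForm G y) where
  add_left := curvForm_add_left G y
  smul_left := fun c => curvForm_smul_left G c y
  swap_left := curvForm_swap_left G y
  swap_pairs := h.curvForm_swap_pairs hy

end Reflection

/-! ### The Riemannian metric of the manifold in a chart. -/

section MetricInChart

variable {M : Type*} [TopologicalSpace M] [ChartedSpace E4 M] [IsManifold (𝓡 4) ∞ M]

/-- The metric `g` read in the preferred chart around `x₀`, as a continuous bilinear form. -/
def metricForm (g : Metric M) (x₀ : M) (y : E4) : E4 →L[ℝ] E4 →L[ℝ] ℝ :=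
  let A : E4 →L[ℝ] E4 →L[ℝ] ℝ := g.inner ((extChartAt (𝓡 4) x₀).symm y)
  let D : E4 →L[ℝ] E4 := mfderiv 𝓘(ℝ, E4) (𝓡 4) (extChartAt (𝓡 4) x₀).symm y
  A.bilinearComp D D

theorem metricForm_apply (g : Metric M) (x₀ : M) (y u v : E4) :
    metricForm g x₀ y u v = g.inner ((extChartAt (𝓡 4) x₀).symm y)
      (mfderiv 𝓘(ℝ, E4) (𝓡 4) (extChartAt (𝓡 4) x₀).symm y u)
      (mfderiv 𝓘(ℝ, E4) (𝓡 4) (extChartAt (𝓡 4) x₀).symm y v) := rfl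

theorem metricInChart_eq (g : Metric M) (x₀ : M) :
    metricInChart g x₀ = fun y u v => metricForm g x₀ y u v := rfl

theorem inner_congr (g : Metric M) {p q : M} (h : p = q) {u v u' v' : E4} (hu : u = u')
    (hv : v = v') :
    g.inner p (u : TangentSpace (𝓡 4) p) (v : TangentSpace (𝓡 4) p)
      = g.inner q (u' : TangentSpace (𝓡 4) q) (v' : TangentSpace (𝓡 4) q) := by
  subst h hu hv
  rfl

theorem inner_self_eq_zero_iff (g : Metric M) (p : M) (u : TangentSpace (𝓡 4) p) :
    g.inner p u u = 0 ↔ u = 0 := by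
  refine ⟨fun h => ?_, fun h => by rw [h, map_zero]⟩
  by_contra hne
  exact (g.pos p u hne).ne' h

theorem inner_self_nonneg (g : Metric M) (p : M) (u : TangentSpace (𝓡 4) p) :
    0 ≤ g.inner p u u := by
  by_cases h : u = 0
  · exact ((inner_self_eq_zero_iff g p u).2 h).ge
  · exact (g.pos p u h).le

theorem metricForm_mfderiv_extChartAt (g : Metric M) {x₀ p : M}
    (hp : p ∈ (extChartAt (𝓡 4) x₀).source) (u v : TangentSpace (𝓡 4) p) :
    metricForm g x₀ (extChartAt (𝓡 4) x₀ p)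
      (mfderiv (𝓡 4) 𝓘(ℝ, E4) (extChartAt (𝓡 4) x₀) p u)
      (mfderiv (𝓡 4) 𝓘(ℝ, E4) (extChartAt (𝓡 4) x₀) p v) = g.inner p u v := by
  have key : ∀ w : TangentSpace (𝓡 4) p,
      (mfderiv 𝓘(ℝ, E4) (𝓡 4) (extChartAt (𝓡 4) x₀).symm (extChartAt (𝓡 4) x₀ p)
        (mfderiv (𝓡 4) 𝓘(ℝ, E4) (extChartAt (𝓡 4) x₀) p w) : E4) = w := fun w => by
    have := mfderivWithin_extChartAt_symm_comp_mfderiv_extChartAt' (I := 𝓡 4) (x := x₀) hp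
    rw [ModelWithCorners.range_eq_univ, mfderivWithin_univ] at this
    exact DFunLike.congr_fun this w
  exact inner_congr g ((extChartAt (𝓡 4) x₀).left_inv hp) (key u) (key v)

theorem isMetricOn_metricForm (g : Metric M) (x₀ : M) :
    IsMetricOn (metricForm g x₀) (extChartAt (𝓡 4) x₀).target where
  isOpen := isOpen_extChartAt_target x₀
  symm y _ u v := by
    rw [metricForm_apply, metricForm_apply]
    exact g.symm _ _ _
  pos y hy u hu := by
    rw [metricForm_apply]
    refine g.pos _ _ fun h0 => hu ?_
    have hinv := isInvertible_mfderivWithin_extChartAt_symm (I := 𝓡 4) (x := x₀) hy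
    rw [ModelWithCorners.range_eq_univ, mfderivWithin_univ] at hinv
    exact hinv.injective (h0.trans (map_zero _).symm)
  contDiffOn := by
    have hs := isOpen_extChartAt_target (I := 𝓡 4) x₀
    refine contDiffOn_clm_apply.2 fun u => contDiffOn_clm_apply.2 fun v => ?_
    rw [← contMDiffOn_iff_contDiffOn]
    have hsymm := contMDiffOn_extChartAt_symm (I := 𝓡 4) (n := ∞) x₀
    -- A constant vector field on the chart target, pushed forward by the inverse chart, is a smooth
    -- field along it; pairing two such fields with `g` gives the coefficients of the metric.
    have hsec : ∀ w : E4, ContMDiffOn 𝓘(ℝ, E4) (𝓡 4).tangent ∞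
        (fun y => (⟨(extChartAt (𝓡 4) x₀).symm y,
          mfderiv 𝓘(ℝ, E4) (𝓡 4) (extChartAt (𝓡 4) x₀).symm y w⟩ : TangentBundle (𝓡 4) M))
        (extChartAt (𝓡 4) x₀).target := fun w => by
      have h1 := hsymm.contMDiffOn_tangentMapWithin (m := ∞) (by simp) hs.uniqueMDiffOn
      have h2 : ContMDiff 𝓘(ℝ, E4) 𝓘(ℝ, E4).tangent ∞
          (fun y => (⟨y, w⟩ : TangentBundle 𝓘(ℝ, E4) E4)) :=
        contMDiff_vectorSpace_iff_contDiff.2 contDiff_const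
      refine (h1.comp h2.contMDiffOn fun y hy => hy).congr fun y hy => ?_
      simp only [tangentMapWithin, Function.comp_apply]
      rw [mfderivWithin_of_isOpen hs hy]
    have hg := g.contMDiff.comp_contMDiffOn hsymm
    intro y hy
    have := ContMDiffWithinAt.clm_bundle_apply₂ (F₁ := E4) (F₂ := E4) (F₃ := ℝ)
      (E₁ := fun x : M => TangentSpace (𝓡 4) x) (E₂ := fun x : M => TangentSpace (𝓡 4) x)
      (E₃ := Bundle.Trivial M ℝ) (hg y hy) (hsec u y hy) (hsec v y hy)
    simp only [Bundle.contMDiffWithinAt_totalSpace] at this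
    exact this.2

/-- For independent vectors the denominator of the sectional curvature is positive; for dependent
ones the numerator vanishes by antisymmetry. -/
theorem curvForm_nonneg {g : Metric M} (hsec : NonnegSectionalCurvature g) (x₀ : M) {y : E4}
    (hy : y ∈ (extChartAt (𝓡 4) x₀).target) (u v : E4) :
    0 ≤ curvForm (metricForm g x₀) y u v u v := by
  have hm := isMetricOn_metricForm g x₀
  have hc := hm.isCurvatureLike hy
  by_cases hli : LinearIndependent ℝ ![u, v]
  · have h1 := hsec x₀ y hy u v hli
    rw [sectionalCurvature, metricInChart_eq, hm.curv_eq hy] at h1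
    simp only at h1
    have hu : u ≠ 0 := hli.ne_zero 0
    have huu := hm.pos y hy u hu
    -- This multiple of the component of `v` orthogonal to `u` has squared norm `G(u,u)` times the
    -- Gram determinant.
    have hw : metricForm g x₀ y u u • v - metricForm g x₀ y u v • u ≠ 0 := fun h0 => by
      have := LinearIndependent.pair_iff.1 hli (-metricForm g x₀ y u v) (metricForm g x₀ y u u)
        (by rw [← h0, neg_smul]; abel)
      exact huu.ne' this.2
    have hp := hm.pos y hy _ hw
    simp only [map_sub, map_smul, sub_apply, smul_apply, smul_eq_mul, hm.symm y hy v u] at hp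
    have hden : 0 < metricForm g x₀ y u u * metricForm g x₀ y v v - metricForm g x₀ y u v ^ 2 := by
      refine pos_of_mul_pos_right ?_ huu.le
      linarith
    by_contra hneg
    exact absurd h1 (not_le.2 (div_neg_of_neg_of_pos (not_le.1 hneg) hden))
  · by_cases hu : u = 0
    · have := hc.smul_left 0 0 v u v
      simp only [hu, zero_smul, zero_mul] at this ⊢
      have h0 := hc.smul_left 0 0 v 0 v
      simp only [zero_smul, zero_mul] at h0
      exact h0.ge
    · rw [LinearIndependent.pair_iff' hu] at hli
      push Not at hli
      obtain ⟨a, rfl⟩ := hli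
      rw [hc.smul_two, hc.self_left, mul_zero]

end MetricInChart

/-! ### Rigidity of smooth involutions. -/

section Involution

open Filter Topology

/-- An involution of a normed space that is the identity on open sets accumulating at a fixed point
is the identity near that point. -/
theorem eventually_eq_of_involution {E : Type*} [NormedAddCommGroup E] [NormedSpace ℝ E]
    {f : E → E} {x₀ : E} (hf : ContDiffAt ℝ 1 f x₀) (hx₀ : f x₀ = x₀)
    (hinv : ∀ᶠ x in 𝓝 x₀, f (f x) = x) (hcl : ∃ᶠ x in 𝓝 x₀, ∀ᶠ z in 𝓝 x, f z = z) :
    ∀ᶠ x in 𝓝 x₀, f x = x := by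
  -- The derivative is the identity at points accumulating at `x₀`, and it is continuous.
  have hd : fderiv ℝ f x₀ = ContinuousLinearMap.id ℝ E := by
    have hc : ContinuousAt (fderiv ℝ f) x₀ :=
      (hf.fderiv_right (m := 0) (by simp)).continuousAt
    by_contra hne
    obtain ⟨x, hx, hx'⟩ := (hcl.and_eventually (hc.eventually_ne hne)).exists
    refine hx' ?_
    rw [EventuallyEq.fderiv_eq (f := id) hx]
    exact fderiv_id
  -- Strict differentiability with error constant 1, applied to the pair `x, f x`, reads `2‖f x - x‖
  -- ≤ ‖f x - x‖` because `f` swaps the two points.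
  have hs := (hf.hasStrictFDerivAt (by simp)).isLittleO.bound (c := 1) one_pos
  rw [hd] at hs
  have ht : Tendsto (fun x => (x, f x)) (𝓝 x₀) (𝓝 (x₀, x₀)) := by
    have := (continuousAt_id (x := x₀)).prodMk hf.continuousAt
    simpa [ContinuousAt, hx₀] using this
  filter_upwards [ht.eventually hs, hinv] with x h1 h2
  simp only [h2, ContinuousLinearMap.id_apply, one_mul] at h1
  have e : f x - x - (x - f x) = (2 : ℝ) • (f x - x) := by
    rw [two_smul]; abel
  rw [e, norm_smul, norm_sub_rev x (f x)] at h1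
  norm_num at h1
  have : ‖f x - x‖ = 0 := by linarith [norm_nonneg (f x - x)]
  exact sub_eq_zero.1 (norm_eq_zero.1 this)

variable {M : Type*} [TopologicalSpace M] [T2Space M] [ChartedSpace E4 M]

/-- A smooth involution of a connected manifold that is the identity near a point is the
identity. -/
theorem eq_id_of_involution [ConnectedSpace M] {s : M → M} (hs : ContMDiff (𝓡 4) (𝓡 4) ∞ s)
    (hinv : ∀ q, s (s q) = q) {p₀ : M} (hp₀ : ∀ᶠ q in 𝓝 p₀, s q = q) (q : M) : s q = q := by
  set A : Set M := {p | ∀ᶠ q in 𝓝 p, s q = q} with hA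
  have hopen : IsOpen A := isOpen_setOfPred_eventually_nhds
  have hclosed : IsClosed A := by
    refine isClosed_of_closure_subset fun p hp => ?_
    have hsp : s p = p := by
      have hfix : IsClosed {q | s q = q} := isClosed_eq hs.continuous continuous_id
      exact (closure_minimal (fun q (hq : q ∈ A) => hq.self_of_nhds) hfix) hp
    set φ := extChartAt (𝓡 4) p with hφ
    have hpφ : p ∈ φ.source := mem_extChartAt_source p
    have hsrc : ∀ᶠ q in 𝓝 p, q ∈ φ.source := extChartAt_source_mem_nhds p
    have hssrc : ∀ᶠ q in 𝓝 p, s q ∈ φ.source :=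
      hs.continuous.continuousAt.eventually (by rw [hsp]; exact hsrc)
    have htgt : φ.target ∈ 𝓝 (φ p) := extChartAt_target_mem_nhds p
    have hback : Tendsto φ.symm (𝓝 (φ p)) (𝓝 p) := by
      have := continuousAt_extChartAt_symm (I := 𝓡 4) p
      rwa [ContinuousAt, extChartAt_to_inv] at this
    have hfwd : Tendsto φ (𝓝 p) (𝓝 (φ p)) := continuousAt_extChartAt (I := 𝓡 4) p
    have hf : ContDiffAt ℝ 1 (φ ∘ s ∘ φ.symm) (φ p) := by
      have h1 := (contMDiffAt_iff.1 (hs p)).2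
      rw [hsp] at h1
      simp only [ModelWithCorners.range_eq_univ, contDiffWithinAt_univ] at h1
      exact h1.of_le (by exact_mod_cast le_top)
    have key := eventually_eq_of_involution hf (by simp [hsp, φ]) (by
      filter_upwards [hback.eventually hssrc, htgt] with x h1 h2
      simp only [Function.comp_apply]
      rw [φ.left_inv h1, hinv, φ.right_inv h2]) (by
      have h1 : ∃ᶠ q in 𝓝 p, ∀ᶠ q' in 𝓝 q, s q' = q' := mem_closure_iff_frequently.1 hp
      have h2 := h1.and_eventually (extChartAt_source_mem_nhds (I := 𝓡 4) p)
      refine hfwd.frequently (h2.mono fun q hq => ?_)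
      have hb : Tendsto φ.symm (𝓝 (φ q)) (𝓝 q) := by
        have := continuousAt_extChartAt_symm' (I := 𝓡 4) hq.2
        rwa [ContinuousAt, φ.left_inv hq.2] at this
      filter_upwards [hb.eventually hq.1, extChartAt_target_mem_nhds' (I := 𝓡 4)
        (φ.map_source hq.2)] with x h1 h2
      simp only [Function.comp_apply]
      rw [h1, φ.right_inv h2])
    change ∀ᶠ q in 𝓝 p, s q = q
    filter_upwards [hfwd.eventually key, hsrc, hssrc] with q h1 h2 h3
    simp only [Function.comp_apply] at h1
    rw [φ.left_inv h2] at h1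
    exact φ.injOn h3 h2 h1
  have : q ∈ A := by
    rw [IsClopen.eq_univ ⟨hclosed, hopen⟩ ⟨p₀, hp₀⟩]
    trivial
  rw [hA, mem_ofPred_eq] at this
  exact this.self_of_nhds

end Involution

/-! ### Action fields of the torus. -/

section Action

open Filter Topology

/-- The element `(exp (i a), exp (i b))` of the torus. -/
def torusExp (a b : ℝ) : Torus := (Circle.exp a, Circle.exp b)

theorem torusExp_add (a b a' b' : ℝ) :
    torusExp (a + a') (b + b') = torusExp a b * torusExp a' b' := by
  simp [torusExp, Circle.exp_add]

theorem torusExp_zero : torusExp 0 0 = 1 := by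
  simp [torusExp]

theorem exists_torusExp_eq (t : Torus) : ∃ a b, torusExp a b = t :=
  ⟨_, _, Prod.ext (Circle.exp_arg t.1) (Circle.exp_arg t.2)⟩

theorem contMDiff_torusExp {F : Type*} [NormedAddCommGroup F] [NormedSpace ℝ F] {α β : F → ℝ}
    (hα : ContDiff ℝ ∞ α) (hβ : ContDiff ℝ ∞ β) :
    ContMDiff 𝓘(ℝ, F) torusModel ∞ (fun y => torusExp (α y) (β y)) :=
  (contMDiff_circleExp.comp hα.contMDiff).prodMk (contMDiff_circleExp.comp hβ.contMDiff)

variable {M : Type*} [TopologicalSpace M] [ChartedSpace E4 M] [MulAction Torus M]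

theorem actionField_def (a b : ℝ) (p : M) :
    actionField a b p =
      mfderiv 𝓘(ℝ, ℝ) (𝓡 4) (fun t : ℝ => torusExp (a * t) (b * t) • p) 0 (1 : ℝ) := rfl

variable [ContMDiffSMul torusModel (𝓡 4) ∞ Torus M]

theorem contMDiff_torusExp_smul {F : Type*} [NormedAddCommGroup F] [NormedSpace ℝ F] {α β : F → ℝ}
    (hα : ContDiff ℝ ∞ α) (hβ : ContDiff ℝ ∞ β) (p : M) :
    ContMDiff 𝓘(ℝ, F) (𝓡 4) ∞ (fun y => torusExp (α y) (β y) • p) :=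
  (contMDiff_torusExp hα hβ).smul contMDiff_const

theorem mdifferentiable_smul (t : Torus) : MDifferentiable (𝓡 4) (𝓡 4) (fun q : M => t • q) :=
  (ContMDiffSMul.contMDiff_const_smul (I := torusModel) (n := ∞) t).mdifferentiable (by simp)

/-- The action fields are invariant under the action. -/
theorem actionField_smul (a b : ℝ) (t : Torus) (p : M) :
    (actionField a b (t • p) : E4) = mfderiv (𝓡 4) (𝓡 4) (fun q : M => t • q) p
      (actionField a b p) := by
  have h1 : (fun s : ℝ => torusExp (a * s) (b * s) • t • p)
      = (fun q : M => t • q) ∘ fun s : ℝ => torusExp (a * s) (b * s) • p := by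
    funext s
    simp only [Function.comp_apply, smul_smul, mul_comm t]
  rw [actionField_def, h1]
  exact mfderiv_comp_apply_of_eq _ (mdifferentiable_smul t p)
    (((contMDiff_torusExp_smul (contDiff_const.mul contDiff_id) (contDiff_const.mul contDiff_id)
      p).mdifferentiable (by simp)) _) (by simp [torusExp_zero]) _

/-- All action fields at `p` are values of one linear map, the differential at the origin of the
orbit map of `ℝ²`. -/
theorem actionField_eq (a b : ℝ) (p : M) :
    (actionField a b p : E4) = a • (actionField 1 0 p : E4) + b • (actionField 0 1 p : E4) := by
  have key : ∀ a b : ℝ, (actionField a b p : E4) =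
      mfderiv 𝓘(ℝ, ℝ × ℝ) (𝓡 4) (fun y : ℝ × ℝ => torusExp y.1 y.2 • p) 0 (a, b) := by
    intro a b
    have h1 : (fun s : ℝ => torusExp (a * s) (b * s) • p)
      = (fun y : ℝ × ℝ => torusExp y.1 y.2 • p) ∘ fun s : ℝ => (a * s, b * s) := rfl
    have hl : HasFDerivAt (fun s : ℝ => (a * s, b * s))
        ((a • ContinuousLinearMap.id ℝ ℝ).prod (b • ContinuousLinearMap.id ℝ ℝ)) 0 :=
      ((hasFDerivAt_id _).const_mul a).prodMk ((hasFDerivAt_id _).const_mul b)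
    rw [actionField_def, h1]
    refine (mfderiv_comp_apply_of_eq (y := (0 : ℝ × ℝ)) _
      (((contMDiff_torusExp_smul contDiff_fst contDiff_snd p).mdifferentiable (by simp)) _)
      hl.differentiableAt.mdifferentiableAt (by simp) _).trans ?_
    rw [mfderiv_eq_fderiv, hl.fderiv]
    exact congrArg (mfderiv 𝓘(ℝ, ℝ × ℝ) (𝓡 4) (fun y : ℝ × ℝ => torusExp y.1 y.2 • p) 0)
      (show ((a • (1 : ℝ), b • (1 : ℝ)) : ℝ × ℝ) = (a, b) by simp)
  rw [key, key 1 0, key 0 1]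
  have : ((a, b) : ℝ × ℝ) = a • (1, 0) + b • (0, 1) := by simp
  rw [this]
  exact (map_add _ _ _).trans (congrArg₂ _ (map_smul _ _ _) (map_smul _ _ _))

end Action

/-! ### Zeros of the action fields. -/

section FixedPoints

open Filter Topology

variable {M : Type*} [TopologicalSpace M] [ChartedSpace E4 M] [IsManifold (𝓡 4) ∞ M]

/-- A differentiable curve with vanishing velocity is constant. -/
theorem eq_of_mfderiv_eq_zero {c : ℝ → M} (hc : MDifferentiable 𝓘(ℝ, ℝ) (𝓡 4) c)
    (h0 : ∀ t, mfderiv 𝓘(ℝ, ℝ) (𝓡 4) c t = 0) (t t' : ℝ) : c t = c t' := by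
  refine IsLocallyConstant.apply_eq_of_isPreconnected
    ((IsLocallyConstant.iff_eventually_eq c).2 fun t₀ => ?_) isPreconnected_univ trivial trivial
  set φ := extChartAt (𝓡 4) (c t₀) with hφ
  have hopen : IsOpen (c ⁻¹' φ.source) := (isOpen_extChartAt_source (c t₀)).preimage hc.continuous
  have ht₀ : t₀ ∈ c ⁻¹' φ.source := mem_extChartAt_source (c t₀)
  have hd : ∀ s ∈ c ⁻¹' φ.source, HasFDerivAt (φ ∘ c) (0 : ℝ →L[ℝ] E4) s := fun s hs => by
    have hφs : MDifferentiableAt (𝓡 4) 𝓘(ℝ, E4) φ (c s) :=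
      mdifferentiableAt_extChartAt (by simpa [hφ] using hs)
    have h1 := (hφs.comp s (hc s)).differentiableAt.hasFDerivAt
    rw [← mfderiv_eq_fderiv, mfderiv_comp s hφs (hc s), h0] at h1
    exact h1.congr_fderiv (ContinuousLinearMap.comp_zero _)
  have hconst := hopen.isOpen_inter_preimage_of_fderiv_eq_zero
    (fun s hs => (hd s hs).differentiableAt.differentiableWithinAt)
    (fun s hs => (hd s hs).fderiv) {φ (c t₀)}
  filter_upwards [hconst.mem_nhds ⟨ht₀, rfl⟩] with s hs
  exact φ.injOn hs.1 ht₀ hs.2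

variable [MulAction Torus M] [ContMDiffSMul torusModel (𝓡 4) ∞ Torus M]

/-- By the group law the velocity of the orbit curve at any time is the image of its velocity at
time 0, so a curve starting with zero velocity stays put. Zeros of the field thus become fixed
points of a one-parameter group. -/
theorem actionField_eq_zero_iff (a b : ℝ) (p : M) :
    actionField a b p = 0 ↔ ∀ t : ℝ, torusExp (a * t) (b * t) • p = p := by
  have hl : ∀ r : ℝ, ContDiff ℝ ∞ (fun t => r * t) := fun r => contDiff_const.mul contDiff_id
  have hc : MDifferentiable 𝓘(ℝ, ℝ) (𝓡 4) (fun t : ℝ => torusExp (a * t) (b * t) • p) :=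
    (contMDiff_torusExp_smul (hl a) (hl b) p).mdifferentiable (by simp)
  constructor
  · intro h t
    refine (eq_of_mfderiv_eq_zero hc (fun t₀ => ?_) t 0).trans (by simp [torusExp_zero])
    have h1 : (fun t : ℝ => torusExp (a * t) (b * t) • p) =
        ((fun q : M => torusExp (a * t₀) (b * t₀) • q) ∘
          fun t : ℝ => torusExp (a * t) (b * t) • p) ∘ fun t => t - t₀ := by
      funext t
      simp only [Function.comp_apply, smul_smul, ← torusExp_add]
      ring_nf
    have hs : HasFDerivAt (fun t : ℝ => t - t₀) (ContinuousLinearMap.id ℝ ℝ) t₀ :=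
      (hasFDerivAt_id t₀).sub_const t₀
    have hz : (mfderiv 𝓘(ℝ, ℝ) (𝓡 4) (fun t : ℝ => torusExp (a * t) (b * t) • p) 0) = 0 := by
      ext
      exact h
    have hg := mdifferentiable_smul (M := M) (torusExp (a * t₀) (b * t₀))
    rw [h1]
    refine ContinuousLinearMap.ext fun v => ?_
    refine (mfderiv_comp_apply_of_eq (y := (0 : ℝ)) _ ((hg _).comp _ (hc 0))
      hs.differentiableAt.mdifferentiableAt (sub_self _) v).trans ?_
    rw [mfderiv_comp _ (hg _) (hc 0), hz, ContinuousLinearMap.comp_zero]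
    rfl
  · intro h
    have h1 : (fun t : ℝ => torusExp (a * t) (b * t) • p) = fun _ => p := funext h
    rw [actionField_def, h1, mfderiv_const]
    rfl

variable [T2Space M]

theorem isOpen_actionField_ne_zero (a b : ℝ) : IsOpen {p : M | actionField a b p ≠ 0} := by
  have h1 : {p : M | actionField a b p ≠ 0} =
      (⋂ t : ℝ, {p : M | torusExp (a * t) (b * t) • p = p})ᶜ := by
    ext p
    simp [actionField_eq_zero_iff]
  rw [h1, isOpen_compl_iff]
  exact isClosed_iInter fun t => isClosed_eq
    (ContMDiffSMul.contMDiff_const_smul (I := torusModel) (I' := 𝓡 4) (n := ∞) _).continuous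
    continuous_id

/-- The action field of a one-parameter group that contains a nontrivial involution at time `π`
does not vanish on an open set. -/
theorem dense_actionField_ne_zero [ConnectedSpace M] [FaithfulSMul Torus M] (a b : ℝ)
    (h1 : torusExp (a * Real.pi) (b * Real.pi) ≠ 1)
    (h2 : torusExp (a * Real.pi) (b * Real.pi) * torusExp (a * Real.pi) (b * Real.pi) = 1) :
    Dense {p : M | actionField a b p ≠ 0} := by
  intro p
  rw [mem_closure_iff_frequently]
  intro hp
  refine h1 (FaithfulSMul.eq_of_smul_eq_smul (α := M) fun q => ?_)
  rw [one_smul]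
  refine eq_id_of_involution (p₀ := p)
    (ContMDiffSMul.contMDiff_const_smul (I := torusModel) (torusExp (a * Real.pi) (b * Real.pi)))
    (fun q => by rw [smul_smul, h2, one_smul]) ?_ q
  filter_upwards [hp] with q hq
  exact (actionField_eq_zero_iff a b q).1 (by simpa using hq) Real.pi

theorem torusExp_pi_zero : torusExp (1 * Real.pi) (0 * Real.pi) ≠ 1 ∧
    torusExp (1 * Real.pi) (0 * Real.pi) * torusExp (1 * Real.pi) (0 * Real.pi) = 1 := by
  refine ⟨fun h => Circle.exp_pi_ne_one (by simpa [torusExp] using congrArg Prod.fst h), ?_⟩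
  rw [← torusExp_add]
  simp [torusExp, ← two_mul]

theorem torusExp_zero_pi : torusExp (0 * Real.pi) (1 * Real.pi) ≠ 1 ∧
    torusExp (0 * Real.pi) (1 * Real.pi) * torusExp (0 * Real.pi) (1 * Real.pi) = 1 := by
  refine ⟨fun h => Circle.exp_pi_ne_one (by simpa [torusExp] using congrArg Prod.snd h), ?_⟩
  rw [← torusExp_add]
  simp [torusExp, ← two_mul]

end FixedPoints

/-! ### Coordinates adapted to a polar action. -/

section AdaptedCoordinates

open Filter Topology

/-- The coordinate space of a surface. -/
abbrev E2 : Type := EuclideanSpace ℝ (Fin 2)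

variable {M : Type*} [TopologicalSpace M] [ChartedSpace E4 M] [IsManifold (𝓡 4) ∞ M]
  [MulAction Torus M]

/-- `F` is a smooth immersion of the open set `O` that is perpendicular to the orbits. -/
structure IsPerpSection (g : Metric M) (F : E2 → M) (O : Set E2) : Prop where
  isOpen : IsOpen O
  contMDiffOn : ContMDiffOn 𝓘(ℝ, E2) (𝓡 4) ∞ F O
  injective : ∀ z ∈ O, Function.Injective (mfderiv 𝓘(ℝ, E2) (𝓡 4) F z)
  perp : ∀ z ∈ O, ∀ (w : E2) (a b : ℝ),
    g.inner (F z) (mfderiv 𝓘(ℝ, E2) (𝓡 4) F z w) (actionField a b (F z)) = 0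

/-- The section of the quotient map is read in a chart of the orbit space and restricted to the
interior of the quadrant, to avoid corners. An open `W` has open image in the orbit space, so some
orbit over the interior meets it; the element `t` moves the section point of that orbit into `W`. -/
theorem exists_isPerpSection [ContinuousConstSMul Torus M] {g : Metric M}
    (hg : IsGeometricallyPolar g) {W : Set M} (hW : IsOpen W) (hne : W.Nonempty) :
    ∃ (F : E2 → M) (O : Set E2) (z : E2) (t : Torus),
      IsPerpSection g F O ∧ z ∈ O ∧ t • F z ∈ W := by
  obtain ⟨cs, hmfd, σ, hσ, hsmooth, hinj⟩ := hg
  let I := modelWithCornersEuclideanQuadrant 2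
  let π : M → OrbitSpace M := Quotient.mk _
  have hπ : IsOpenMap π := isOpenMap_quotient_mk'_mul
  obtain ⟨p₁, hp₁⟩ := hne
  let e := extChartAt I (π p₁)
  have hmem : π p₁ ∈ e.source := mem_extChartAt_source _
  have h1 : e.symm ⁻¹' (π '' W) ∈ 𝓝[range I] (e (π p₁)) :=
    (continuousAt_extChartAt_symm (I := I) (π p₁)).continuousWithinAt (by
      rw [extChartAt_to_inv]
      exact (hπ W hW).mem_nhds ⟨p₁, hp₁, rfl⟩)
  have h2 : e.target ∈ 𝓝[range I] (e (π p₁)) := extChartAt_target_mem_nhdsWithin _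
  obtain ⟨V, hV, hpV, hVsub⟩ := mem_nhdsWithin.1 (inter_mem h1 h2)
  -- Boundary points of the quadrant are limits of interior ones, so the neighbourhood `V` contains
  -- an interior point even when `π p₁` lies on an edge or a corner.
  have hcl : e (π p₁) ∈ closure (interior (range I)) :=
    I.range_subset_closure_interior (extChartAt_target_subset_range _ (e.map_source hmem))
  obtain ⟨z, hzV, hzI⟩ := mem_closure_iff.1 hcl V hV hpV
  obtain ⟨⟨p, hpW, hpz⟩, hzt⟩ := hVsub ⟨hzV, interior_subset hzI⟩
  have hOt : ∀ z ∈ interior (range I) ∩ I.symm ⁻¹' (chartAt _ (π p₁)).target, z ∈ e.target :=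
    fun z hz => by
      simp only [e, extChartAt_target]
      exact ⟨hz.2, interior_subset hz.1⟩
  have hO : IsOpen (interior (range I) ∩ I.symm ⁻¹' (chartAt _ (π p₁)).target) :=
    isOpen_interior.inter ((chartAt _ (π p₁)).open_target.preimage I.continuous_symm)
  have hes : ∀ z ∈ interior (range I) ∩ I.symm ⁻¹' (chartAt _ (π p₁)).target,
      ContMDiffAt 𝓘(ℝ, E2) I ∞ e.symm z := fun z hz =>
    ((contMDiffOn_extChartAt_symm (I := I) (n := ∞) (π p₁)).mono hOt).contMDiffAt
      (hO.mem_nhds hz)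
  have hd : ∀ z ∈ interior (range I) ∩ I.symm ⁻¹' (chartAt _ (π p₁)).target, ∀ w : E2,
      (mfderiv 𝓘(ℝ, E2) (𝓡 4) (σ ∘ e.symm) z w : E4) =
        mfderiv I (𝓡 4) σ (e.symm z) (mfderiv 𝓘(ℝ, E2) I e.symm z w) := fun z hz w =>
    mfderiv_comp_apply z (hsmooth.mdifferentiable (by simp) _)
      ((hes z hz).mdifferentiableAt (by simp)) w
  refine ⟨σ ∘ e.symm, interior (range I) ∩ I.symm ⁻¹' (chartAt _ (π p₁)).target, z, ?_⟩
  have hrel : π (σ (e.symm z)) = π p := (hσ _).trans hpz.symm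
  obtain ⟨t, ht⟩ : ∃ t : Torus, t • σ (e.symm z) = p :=
    MulAction.orbitRel_apply.1 (Setoid.symm' _ (Quotient.exact hrel))
  have hzO : z ∈ interior (range I) ∩ I.symm ⁻¹' (chartAt _ (π p₁)).target := by
    refine ⟨hzI, ?_⟩
    simp only [e, extChartAt_target] at hzt
    exact hzt.1
  refine ⟨t, ⟨hO, fun z hz => ?_, fun z hz => ?_, fun z hz w a b => ?_⟩, hzO, ?_⟩
  · exact (hsmooth.contMDiffAt.comp z (hes z hz)).contMDiffWithinAt
  · have hinv := isInvertible_mfderivWithin_extChartAt_symm (I := I) (x := π p₁) (hOt z hz)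
    rw [mfderivWithin_of_mem_nhds (mem_interior_iff_mem_nhds.1 hz.1)] at hinv
    intro w w' hww
    exact hinv.injective ((hinj (e.symm z)).1 (((hd z hz w).symm.trans hww).trans (hd z hz w')))
  · exact (inner_congr g rfl (hd z hz w) rfl).trans ((hinj (e.symm z)).2 _ a b)
  · exact ht ▸ hpW

/-- The map `(z, a, b) ↦ (exp (i a), exp (i b)) • F z`. -/
def toricMap (F : E2 → M) (y : E2 × ℝ × ℝ) : M := torusExp y.2.1 y.2.2 • F y.1

variable [ContMDiffSMul torusModel (𝓡 4) ∞ Torus M] {g : Metric M} {F : E2 → M} {O : Set E2}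

namespace IsPerpSection

theorem contMDiffAt_toricMap (h : IsPerpSection g F O) {y : E2 × ℝ × ℝ} (hy : y.1 ∈ O) :
    ContMDiffAt 𝓘(ℝ, E2 × ℝ × ℝ) (𝓡 4) ∞ (toricMap F) y := by
  have h1 : ContMDiffAt 𝓘(ℝ, E2 × ℝ × ℝ) torusModel ∞
      (fun y : E2 × ℝ × ℝ => torusExp y.2.1 y.2.2) y :=
    (contMDiff_torusExp (contDiff_fst.comp contDiff_snd)
      (contDiff_snd.comp contDiff_snd)).contMDiffAt
  have h2 : ContMDiffAt 𝓘(ℝ, E2 × ℝ × ℝ) (𝓡 4) ∞ (fun y : E2 × ℝ × ℝ => F y.1) y :=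
    (h.contMDiffOn.contMDiffAt (h.isOpen.mem_nhds hy)).comp y contDiff_fst.contMDiff.contMDiffAt
  exact h1.smul h2

/-- Since the torus is abelian, moving the angles is following a one-parameter group through the
image point, so angle directions map to action fields; these are carried back to the section by
invariance. -/
theorem mfderiv_toricMap (h : IsPerpSection g F O) {y : E2 × ℝ × ℝ} (hy : y.1 ∈ O)
    (u : E2 × ℝ × ℝ) :
    (mfderiv 𝓘(ℝ, E2 × ℝ × ℝ) (𝓡 4) (toricMap F) y u : E4) =
      mfderiv (𝓡 4) (𝓡 4) (fun q : M => torusExp y.2.1 y.2.2 • q) (F y.1)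
        ((mfderiv 𝓘(ℝ, E2) (𝓡 4) F y.1 u.1 : E4) + actionField u.2.1 u.2.2 (F y.1)) := by
  have hΦ := (h.contMDiffAt_toricMap hy).mdifferentiableAt (by simp)
  have hF := (h.contMDiffOn.contMDiffAt (h.isOpen.mem_nhds hy)).mdifferentiableAt (by simp)
  have e1 : (mfderiv 𝓘(ℝ, E2 × ℝ × ℝ) (𝓡 4) (toricMap F) y ((u.1, 0) : E2 × ℝ × ℝ) : E4) =
      mfderiv (𝓡 4) (𝓡 4) (fun q : M => torusExp y.2.1 y.2.2 • q) (F y.1)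
        (mfderiv 𝓘(ℝ, E2) (𝓡 4) F y.1 u.1) := by
    have hi : HasFDerivAt (fun z : E2 => (z, y.2)) (ContinuousLinearMap.inl ℝ E2 (ℝ × ℝ)) y.1 :=
      hasFDerivAt_prodMk_left _ _
    have c1 := mfderiv_comp_apply (x := y.1) (f := fun z : E2 => (z, y.2)) hΦ
      hi.differentiableAt.mdifferentiableAt u.1
    rw [mfderiv_eq_fderiv, hi.fderiv] at c1
    refine c1.symm.trans ?_
    exact mfderiv_comp_apply (x := y.1) (mdifferentiable_smul (torusExp y.2.1 y.2.2) _) hF u.1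
  have e2 : (mfderiv 𝓘(ℝ, E2 × ℝ × ℝ) (𝓡 4) (toricMap F) y ((0, u.2) : E2 × ℝ × ℝ) : E4) =
      actionField u.2.1 u.2.2 (toricMap F y) := by
    have hl : HasFDerivAt (fun s : ℝ => (y.1, y.2.1 + u.2.1 * s, y.2.2 + u.2.2 * s))
        ((0 : ℝ →L[ℝ] E2).prod ((u.2.1 • ContinuousLinearMap.id ℝ ℝ).prod
          (u.2.2 • ContinuousLinearMap.id ℝ ℝ))) 0 :=
      (hasFDerivAt_const _ _).prodMk ((((hasFDerivAt_id _).const_mul u.2.1).const_add _).prodMk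
        (((hasFDerivAt_id _).const_mul u.2.2).const_add _))
    have c1 := mfderiv_comp_apply_of_eq (x := (0 : ℝ)) (y := y)
      (f := fun s : ℝ => (y.1, y.2.1 + u.2.1 * s, y.2.2 + u.2.2 * s)) hΦ
      hl.differentiableAt.mdifferentiableAt (by simp) (1 : ℝ)
    rw [mfderiv_eq_fderiv, hl.fderiv] at c1
    have c2 : toricMap F ∘ (fun s : ℝ => (y.1, y.2.1 + u.2.1 * s, y.2.2 + u.2.2 * s))
        = fun s : ℝ => torusExp (u.2.1 * s) (u.2.2 * s) • toricMap F y := by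
      funext s
      simp only [Function.comp_apply, toricMap, smul_smul, ← torusExp_add]
      rw [add_comm y.2.1, add_comm y.2.2]
    rw [actionField_def, ← c2]
    refine Eq.trans ?_ c1.symm
    exact congrArg (mfderiv 𝓘(ℝ, E2 × ℝ × ℝ) (𝓡 4) (toricMap F) y)
      (show ((0, u.2) : E2 × ℝ × ℝ) = (0, u.2.1 • 1, u.2.2 • 1) by simp)
  have e3 : u = (u.1, 0) + (0, u.2) := by simp
  conv_lhs => rw [e3]
  refine (map_add _ _ _).trans ((congrArg₂ _ e1 (e2.trans (actionField_smul _ _ _ _))).trans ?_)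
  exact ((mfderiv (𝓡 4) (𝓡 4) (fun q : M => torusExp y.2.1 y.2.2 • q) (F y.1)).map_add _ _).symm

/-- The metric in the coordinates given by `toricMap F` does not depend on the angles, and it is
diagonal in the angles. -/
theorem inner_mfderiv_toricMap (h : IsPerpSection g F O) (hinv : IsInvariant g)
    (horth : ∀ p : M, g.inner p (actionField 1 0 p) (actionField 0 1 p) = 0)
    {y : E2 × ℝ × ℝ} (hy : y.1 ∈ O) (u v : E2 × ℝ × ℝ) :
    g.inner (toricMap F y) (mfderiv 𝓘(ℝ, E2 × ℝ × ℝ) (𝓡 4) (toricMap F) y u)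
        (mfderiv 𝓘(ℝ, E2 × ℝ × ℝ) (𝓡 4) (toricMap F) y v) =
      g.inner (F y.1) (mfderiv 𝓘(ℝ, E2) (𝓡 4) F y.1 u.1) (mfderiv 𝓘(ℝ, E2) (𝓡 4) F y.1 v.1)
      + u.2.1 * v.2.1 * g.inner (F y.1) (actionField 1 0 (F y.1)) (actionField 1 0 (F y.1))
      + u.2.2 * v.2.2 * g.inner (F y.1) (actionField 0 1 (F y.1)) (actionField 0 1 (F y.1)) := by
  refine (inner_congr g rfl (h.mfderiv_toricMap hy u) (h.mfderiv_toricMap hy v)).trans ?_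
  refine (hinv _ _ _ _).trans ?_
  have p1 := h.perp y.1 hy u.1
  have p2 := h.perp y.1 hy v.1
  have o := horth (F y.1)
  set q := F y.1
  let B : E4 →L[ℝ] E4 →L[ℝ] ℝ := g.inner q
  have hB : ∀ a b : E4, B a b = B b a := fun a b => g.symm q a b
  let A : E4 := mfderiv 𝓘(ℝ, E2) (𝓡 4) F y.1 u.1
  let A' : E4 := mfderiv 𝓘(ℝ, E2) (𝓡 4) F y.1 v.1
  let X : E4 := actionField 1 0 q
  let Y : E4 := actionField 0 1 q
  refine (congrArg₂ (fun s t : E4 => B (A + s) (A' + t)) (actionField_eq u.2.1 u.2.2 q)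
    (actionField_eq v.2.1 v.2.2 q)).trans ?_
  change B (A + (u.2.1 • X + u.2.2 • Y)) (A' + (v.2.1 • X + v.2.2 • Y)) =
    B A A' + u.2.1 * v.2.1 * B X X + u.2.2 * v.2.2 * B Y Y
  have a1 : B A X = 0 := p1 1 0
  have a2 : B A Y = 0 := p1 0 1
  have a3 : B X A' = 0 := (hB _ _).trans (p2 1 0)
  have a4 : B Y A' = 0 := (hB _ _).trans (p2 0 1)
  have a5 : B X Y = 0 := o
  have a6 : B Y X = 0 := (hB _ _).trans o
  simp only [map_add, map_smul, add_apply, smul_apply, a1, a2, a3, a4, a5, a6, smul_eq_mul]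
  ring

end IsPerpSection

end AdaptedCoordinates

/-! ### Isotropic curvature where both action fields are nonzero. -/

section Main

open Filter Topology

variable {M : Type*} [TopologicalSpace M] [ChartedSpace E4 M] [IsManifold (𝓡 4) ∞ M]
  [MulAction Torus M] [ContMDiffSMul torusModel (𝓡 4) ∞ Torus M] {g : Metric M} {F : E2 → M}
  {O : Set E2}

omit [ContMDiffSMul torusModel (𝓡 4) ∞ Torus M] in
theorem IsPerpSection.mono (h : IsPerpSection g F O) {O' : Set E2} (hO' : IsOpen O')
    (hsub : O' ⊆ O) : IsPerpSection g F O' where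
  isOpen := hO'
  contMDiffOn := h.contMDiffOn.mono hsub
  injective z hz := h.injective z (hsub hz)
  perp z hz := h.perp z (hsub hz)

/-- The coordinate basis of `E2 × ℝ × ℝ`. -/
def toricBasis : Fin 4 → E2 × ℝ × ℝ :=
  ![(EuclideanSpace.single 0 1, 0, 0), (EuclideanSpace.single 1 1, 0, 0), (0, 1, 0), (0, 0, 1)]

theorem exists_eq_sum_toricBasis (v : E2 × ℝ × ℝ) : ∃ x : Fin 4 → ℝ, v = ∑ i, x i • toricBasis i := by
  refine ⟨![v.1 0, v.1 1, v.2.1, v.2.2], ?_⟩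
  refine Prod.ext ?_ (Prod.ext ?_ ?_)
  · ext i
    fin_cases i <;> simp [Fin.sum_univ_four, toricBasis]
  · simp [Fin.sum_univ_four, toricBasis]
  · simp [Fin.sum_univ_four, toricBasis]

/-- The linear map that multiplies the two angles by `α` and `β`. -/
def angleScaling (α β : ℝ) : E2 × ℝ × ℝ →L[ℝ] E2 × ℝ × ℝ :=
  (ContinuousLinearMap.fst ℝ E2 (ℝ × ℝ)).prod
    (((α • ContinuousLinearMap.fst ℝ ℝ ℝ).prod (β • ContinuousLinearMap.snd ℝ ℝ ℝ)) ∘L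
      ContinuousLinearMap.snd ℝ E2 (ℝ × ℝ))

theorem angleScaling_apply (α β : ℝ) (u : E2 × ℝ × ℝ) :
    angleScaling α β u = (u.1, α * u.2.1, β * u.2.2) := rfl

theorem exists_angleScaling (m : Fin 4) (hm : m = 2 ∨ m = 3) :
    ∃ α β : ℝ, α * α = 1 ∧ β * β = 1 ∧
      ∀ i, angleScaling α β (toricBasis i) = (if i = m then (-1 : ℝ) else 1) • toricBasis i := by
  rcases hm with rfl | rfl
  · refine ⟨-1, 1, by norm_num, by norm_num, fun i => ?_⟩
    fin_cases i <;> simp [angleScaling_apply, toricBasis]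
  · refine ⟨1, -1, by norm_num, by norm_num, fun i => ?_⟩
    fin_cases i <;> simp [angleScaling_apply, toricBasis]

/-- The expression `R₁₃₁₃ + R₁₄₁₄ + R₂₃₂₃ + R₂₄₂₄ - 2 R₁₂₃₄` for the metric `g` in a chart. -/
def isotropicForm (g : Metric M) (x₀ : M) (y e₁ e₂ e₃ e₄ : E4) : ℝ :=
  curvForm (metricForm g x₀) y e₁ e₃ e₁ e₃ + curvForm (metricForm g x₀) y e₁ e₄ e₁ e₄
    + curvForm (metricForm g x₀) y e₂ e₃ e₂ e₃ + curvForm (metricForm g x₀) y e₂ e₄ e₂ e₄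
    - 2 * curvForm (metricForm g x₀) y e₁ e₂ e₃ e₄

theorem IsPerpSection.isotropicForm_nonneg (h : IsPerpSection g F O) (hinv : IsInvariant g)
    (horth : ∀ p : M, g.inner p (actionField 1 0 p) (actionField 0 1 p) = 0)
    (hX : ∀ z ∈ O, actionField 1 0 (F z) ≠ 0) (hY : ∀ z ∈ O, actionField 0 1 (F z) ≠ 0)
    (hsec : NonnegSectionalCurvature g) {x₀ : M} {y : E2 × ℝ × ℝ} (hy : y.1 ∈ O)
    (hx₀ : toricMap F y ∈ (extChartAt (𝓡 4) x₀).source) (e₁ e₂ e₃ e₄ : E4) :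
    0 ≤ isotropicForm g x₀ (extChartAt (𝓡 4) x₀ (toricMap F y)) e₁ e₂ e₃ e₄ := by
  set φ := extChartAt (𝓡 4) x₀ with hφ
  set f : E2 × ℝ × ℝ → E4 := φ ∘ toricMap F with hf
  set U' : Set (E2 × ℝ × ℝ) := Prod.fst ⁻¹' O ∩ toricMap F ⁻¹' φ.source with hU'
  have hsmooth : ContMDiffOn 𝓘(ℝ, E2 × ℝ × ℝ) (𝓡 4) ∞ (toricMap F) (Prod.fst ⁻¹' O) :=
    fun x hx => (h.contMDiffAt_toricMap hx).contMDiffWithinAt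
  have hopen : IsOpen U' := hsmooth.continuousOn.isOpen_inter_preimage
    (h.isOpen.preimage continuous_fst) (isOpen_extChartAt_source x₀)
  have hfd : ContDiffOn ℝ ∞ f U' := by
    rw [← contMDiffOn_iff_contDiffOn]
    refine (contMDiffOn_extChartAt (I := 𝓡 4) (n := ∞) (x := x₀)).comp
      (hsmooth.mono inter_subset_left) fun x hx => ?_
    simpa [hφ] using hx.2
  have hm := isMetricOn_metricForm g x₀
  have hdf : ∀ x ∈ U', ∀ u, fderiv ℝ f x u = (mfderiv (𝓡 4) 𝓘(ℝ, E4) φ (toricMap F x)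
      (mfderiv 𝓘(ℝ, E2 × ℝ × ℝ) (𝓡 4) (toricMap F) x u) : E4) := fun x hx u => by
    rw [← mfderiv_eq_fderiv]
    exact mfderiv_comp_apply x (mdifferentiableAt_extChartAt (by simpa [hφ] using hx.2))
      ((h.contMDiffAt_toricMap hx.1).mdifferentiableAt (by simp)) u
  -- The coefficients depend on `x.1` alone and the angle components enter only as products `u.2.1 *
  -- v.2.1` and `u.2.2 * v.2.2`, so changing the sign of one angle component in both `u` and `v`
  -- changes nothing.
  have hG : ∀ x ∈ U', ∀ u v, metricForm g x₀ (f x) (fderiv ℝ f x u) (fderiv ℝ f x v) =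
      g.inner (F x.1) (mfderiv 𝓘(ℝ, E2) (𝓡 4) F x.1 u.1) (mfderiv 𝓘(ℝ, E2) (𝓡 4) F x.1 v.1)
      + u.2.1 * v.2.1 * g.inner (F x.1) (actionField 1 0 (F x.1)) (actionField 1 0 (F x.1))
      + u.2.2 * v.2.2 * g.inner (F x.1) (actionField 0 1 (F x.1)) (actionField 0 1 (F x.1)) :=
    fun x hx u v => by
      rw [hdf x hx, hdf x hx, ← h.inner_mfderiv_toricMap hinv horth hx.1]
      exact metricForm_mfderiv_extChartAt g hx.2 _ _
  -- A null vector makes three nonnegative terms sum to zero; nonvanishing action fields and the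
  -- immersed section then kill each component.
  have hinj : ∀ x ∈ U', ∀ u, fderiv ℝ f x u = 0 → u = 0 := fun x hx u hu => by
    have h0 := hG x hx u u
    rw [hu, map_zero] at h0
    have n1 := inner_self_nonneg g (F x.1) (mfderiv 𝓘(ℝ, E2) (𝓡 4) F x.1 u.1)
    have n2 := g.pos (F x.1) _ (hX x.1 hx.1)
    have n3 := g.pos (F x.1) _ (hY x.1 hx.1)
    have m2 := mul_nonneg (mul_self_nonneg u.2.1) n2.le
    have m3 := mul_nonneg (mul_self_nonneg u.2.2) n3.le
    have z2 := (mul_eq_zero.1 (by linarith : u.2.1 * u.2.1 * _ = (0 : ℝ))).resolve_right n2.ne'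
    have z3 := (mul_eq_zero.1 (by linarith : u.2.2 * u.2.2 * _ = (0 : ℝ))).resolve_right n3.ne'
    have z1 := (inner_self_eq_zero_iff g _ _).1 (by linarith :
      g.inner (F x.1) (mfderiv 𝓘(ℝ, E2) (𝓡 4) F x.1 u.1) (mfderiv 𝓘(ℝ, E2) (𝓡 4) F x.1 u.1) = 0)
    exact Prod.ext (h.injective x.1 hx.1 (z1.trans (map_zero _).symm))
      (Prod.ext (mul_self_eq_zero.1 z2) (mul_self_eq_zero.1 z3))
  have hiso := hm.isIsometryOn_pullback hopen hfd (fun x hx => φ.map_source hx.2) hinj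
  have hdim : Module.finrank ℝ (E2 × ℝ × ℝ) = Module.finrank ℝ E4 := by simp
  have hyU : y ∈ U' := ⟨hy, hx₀⟩
  have hfy : f y ∈ φ.target := φ.map_source hx₀
  refine (hm.isCurvatureLike hfy).isotropic_nonneg (curvForm_nonneg hsec x₀ hfy)
    (fun i => fderiv ℝ f y (toricBasis i)) (fun v => ?_) (fun m hmm i j k l => ?_) e₁ e₂ e₃ e₄
  · obtain ⟨u, rfl⟩ := hiso.surjective hdim hyU v
    obtain ⟨x, hx⟩ := exists_eq_sum_toricBasis u
    exact ⟨x, by simp only [← map_smul, ← map_sum, ← hx]⟩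
  · obtain ⟨α, β, hα, hβ, hαβ⟩ := exists_angleScaling m hmm
    simp only [← map_smul, ← hαβ]
    rw [hiso.curvForm_eq hdim hyU, hiso.curvForm_eq hdim hyU]
    -- With `α = -1` or `β = -1` this translation turns the sign change into the reflection `a ↦ 2a₀
    -- - a` about the angle of `y`, which fixes `y`.
    refine hiso.metric_source.curvForm_affine (c := (0, (1 - α) * y.2.1, (1 - β) * y.2.2)) hyU ?_
      (fun x hx hx' u v => ?_) _ _ _ _
    · rw [angleScaling_apply]
      refine Prod.ext (add_zero _) (Prod.ext ?_ ?_) <;> simp <;> ring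
    · refine (hG _ hx' _ _).trans (Eq.trans ?_ (hG x hx u v).symm)
      have e : (angleScaling α β x + (0, (1 - α) * y.2.1, (1 - β) * y.2.2)).1 = x.1 := by
        simp [angleScaling_apply]
      rw [e]
      simp only [angleScaling_apply]
      rw [mul_mul_mul_comm α, mul_mul_mul_comm β, hα, hβ, one_mul, one_mul]

end Main

end Toric4

end
-- Extension to all points by density.
theorem mainTheorem4 (M : Type*) [TopologicalSpace M] [T2Space M] [SecondCountableTopology M]
    [ConnectedSpace M] [ChartedSpace Toric4.E4 M] [IsManifold (𝓡 4) ∞ M]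
    [MulAction Toric4.Torus M] [ContMDiffSMul Toric4.torusModel (𝓡 4) ∞ Toric4.Torus M]
    [FaithfulSMul Toric4.Torus M]
    (g : Toric4.Metric M) (hg : Toric4.IsDiagonalMetric g)
    (hsec : Toric4.NonnegSectionalCurvature g) :
    Toric4.NonnegIsotropicCurvature g := by
  open Toric4 Filter Topology Set in
  intro x₀ y hy e _
  have hm := isMetricOn_metricForm g x₀
  rw [isotropicCurvature, metricInChart_eq, hm.curv_eq hy, hm.curv_eq hy, hm.curv_eq hy,
    hm.curv_eq hy, hm.curv_eq hy]
  change 0 ≤ isotropicForm g x₀ y (e 0) (e 1) (e 2) (e 3)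
  have : ContinuousSMul Torus M := ContMDiffSMul.continuousSMul (I := torusModel) (I' := 𝓡 4) ∞
  have hcont : ContinuousOn (fun y => isotropicForm g x₀ y (e 0) (e 1) (e 2) (e 3))
      (extChartAt (𝓡 4) x₀).target :=
    ((((hm.continuousOn_curvForm _ _ _ _).add (hm.continuousOn_curvForm _ _ _ _)).add
      (hm.continuousOn_curvForm _ _ _ _)).add (hm.continuousOn_curvForm _ _ _ _)).sub
      (continuousOn_const.mul (hm.continuousOn_curvForm _ _ _ _))
  -- A negative value persists on an open set when the four vectors are kept constant in the chart.
  -- They need not stay orthonormal there; the inequality at good points holds for any four vectors.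
  by_contra! hneg
  have hopen := hcont.isOpen_inter_preimage hm.isOpen (isOpen_Iio (a := (0 : ℝ)))
  have hW₀ := (continuousOn_extChartAt (I := 𝓡 4) x₀).isOpen_inter_preimage
    (isOpen_extChartAt_source x₀) hopen
  have hXo := isOpen_actionField_ne_zero (M := M) 1 0
  have hYo := isOpen_actionField_ne_zero (M := M) 0 1
  have hXd := dense_actionField_ne_zero (M := M) 1 0 torusExp_pi_zero.1 torusExp_pi_zero.2
  have hYd := dense_actionField_ne_zero (M := M) 0 1 torusExp_zero_pi.1 torusExp_zero_pi.2
  have hne : ((extChartAt (𝓡 4) x₀).source ∩ extChartAt (𝓡 4) x₀ ⁻¹'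
      ((extChartAt (𝓡 4) x₀).target ∩ (fun y => isotropicForm g x₀ y (e 0) (e 1) (e 2) (e 3)) ⁻¹'
        Iio 0)).Nonempty := by
    refine ⟨(extChartAt (𝓡 4) x₀).symm y, (extChartAt (𝓡 4) x₀).map_target hy, ?_⟩
    rw [mem_preimage, (extChartAt (𝓡 4) x₀).right_inv hy]
    exact ⟨hy, hneg⟩
  have hne' := (hXd.inter_of_isOpen_left hYd hXo).inter_open_nonempty _ hW₀ hne
  obtain ⟨F, O, z, t, hF, hz, htW⟩ :=
    exists_isPerpSection hg.polar (hW₀.inter (hXo.inter hYo)) hne'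
  have hO' : IsOpen (O ∩ F ⁻¹' ({p | actionField 1 0 p ≠ 0} ∩ {p | actionField 0 1 p ≠ 0})) :=
    hF.contMDiffOn.continuousOn.isOpen_inter_preimage hF.isOpen (hXo.inter hYo)
  obtain ⟨a, b, rfl⟩ := exists_torusExp_eq t
  -- Vanishing of an action field is constant along orbits, so the good set may be tested on the
  -- section.
  have hz' : ∀ c d : ℝ, actionField c d (torusExp a b • F z) ≠ 0 → actionField c d (F z) ≠ 0 :=
    fun c d hcd h0 => hcd ((actionField_smul c d _ _).trans (by rw [h0]; exact map_zero _))
  have key := (hF.mono hO' inter_subset_left).isotropicForm_nonneg hg.invariant hg.orthogonal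
    (fun w hw => hw.2.1) (fun w hw => hw.2.2) hsec (x₀ := x₀) (y := (z, a, b))
    ⟨hz, hz' 1 0 htW.2.1, hz' 0 1 htW.2.2⟩ htW.1.1 (e 0) (e 1) (e 2) (e 3)
  exact absurd key (not_le.2 htW.1.2.2)
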